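/- A directed graph $E=(E^0,E^1,r,s)$ consists of countable sets $E^0$ (vertices) and $E^1$ (edges) and range and source maps $r,s:E^1\to E^0$. It is row-finite if $r^{-1}(v)$ is finite for every $v\in E^0$, and has no sources if $r^{-1}(v)\neq\emptyset$ for every $v\in E^0$. A path is a (finite or infinite) sequence of edges $\mu_1\mu_2\cdots$ with $s(\mu_i)=r(\mu_{i+1})$; vertices are the paths of length $0$. Let $P(E)$ be the set of finite paths and $E^\infty$ the set of infinite paths; write $|\mu|$ for the length of $\mu\in P(E)$, and extend $r$ and $s$ to paths by $r(\mu)=r(\mu_1)$ and, for finite $\mu$, $s(\mu)=s(\mu_{|\mu|})$, with $r(v)=s(v)=v$ for a vertex $v$. For a commutative ring $R$ with identity and with an involution $t\mapsto\overline t$ (an additive and multiplicative map with $\overline{\overline t}=t$), and for $E$ row-finite with no sources, the Leavitt path algebra $L_R(E)$ is the universal associative (not necessarily unital) $R$-algebra generated by elements $p_v$ ($v\in E^0$), $s_e$, $s_{e^*}$ ($e\in E^1$) such that the $p_v$ are mutually orthogonal idempotents, $p_{r(e)}s_e=s_e=s_ep_{s(e)}$, $p_{s(e)}s_{e^*}=s_{e^*}=s_{e^*}p_{r(e)}$,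 $s_{e^*}s_f=\delta_{e,f}\,p_{s(e)}$, and $p_v=\sum_{r(e)=v}s_es_{e^*}$ for all $v\in E^0$. Its involution is the conjugate-linear, additive, product-reversing involution with $p_v^*=p_v$ and $s_e^*=s_{e^*}$. For $\mu\in P(E)$ put $s_\mu=s_{\mu_1}\cdots s_{\mu_{|\mu|}}$ (and $s_v=p_v$ for a vertex $v$). The diagonal is $D(E)=\operatorname{span}_R\{s_\mu s_\mu^*:\mu\in P(E)\}$. The graph groupoid $G_E$ consists of all $(x,k,y)\in E^\infty\times\mathbb Z\times E^\infty$ for which there are $m,n\in\mathbb N$ with $k=m-n$ and $x_{m+i}=y_{n+i}$ for all $i\geq 1$. Elements $(x,k,y)$ and $(y',l,z)$ are composable exactly when $y=y'$, and then $(x,k,y)(y,l,z)=(x,k+l,z)$. The topology on $G_E$ has as basis the sets $Z(\mu,\nu)=\{(\mu z,|\mu|-|\nu|,\nu z): z\in E^\infty,\ r(z)=s(\mu)\}$ for $\mu,\nu\in P(E)$ with $s(\mu)=s(\nu)$. An isomorphism of topological groupoids is a homeomorphism that is also an isomorphism of groupoids. **Theorem.** Let $E$ and $F$ be row-finite directed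 graphs with no sources, and let $R$ be an integral domain with identity, equipped with an involution. The following are equivalent. 1. There is a ring $*$-isomorphism $\pi:L_R(E)\to L_R(F)$ (a bijection that preserves sums, products and the involution, but need not be $R$-linear) such that $\pi(D(E))=D(F)$. 2. The topological groupoids $G_E$ and $G_F$ are isomorphic. -/

import Mathlib

universe u v w u' v' w'

set_option linter.checkUnivs false

/-- A directed graph: countable sets of vertices and of edges, with range and source maps. -/
structure DirectedGraph where
  /-- the set of vertices -/
  Vert : Type u
  /-- the set of edges -/
  Edge : Type v
  /-- the range map -/
  r : Edge → Vert
  /-- the source map -/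
  s : Edge → Vert
  countable_vert : Countable Vert
  countable_edge : Countable Edge

namespace DirectedGraph

/-- Every vertex receives only finitely many edges. -/
def RowFinite (E : DirectedGraph.{u, v}) : Prop :=
  ∀ v : E.Vert, {e : E.Edge | E.r e = v}.Finite

/-- Every vertex receives at least one edge. -/
def NoSources (E : DirectedGraph.{u, v}) : Prop :=
  ∀ v : E.Vert, {e : E.Edge | E.r e = v}.Nonempty

/-! ### Paths: consecutive edges satisfy `s (μ i) = r (μ (i + 1))` -/

/-- The list of edges is a path with range `v`; the empty list is the path `v` of length `0`. -/
def IsPathFrom (E : DirectedGraph.{u, v}) : E.Vert → List E.Edge → Prop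
  | _, [] => True
  | v, e :: l => E.r e = v ∧ E.IsPathFrom (E.s e) l

/-- The source of the path with range `v` and the given edges. -/
def sourceFrom (E : DirectedGraph.{u, v}) : E.Vert → List E.Edge → E.Vert
  | v, [] => v
  | _, e :: l => E.sourceFrom (E.s e) l

/-- A finite path, given by its range and its list of edges. -/
structure FinPath (E : DirectedGraph.{u, v}) where
  range : E.Vert
  edges : List E.Edge
  isPath : E.IsPathFrom range edges

/-- The source of a finite path. -/
def FinPath.source {E : DirectedGraph.{u, v}} (μ : E.FinPath) : E.Vert :=
  E.sourceFrom μ.range μ.edges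

/-- The length of a finite path. -/
def FinPath.length {E : DirectedGraph.{u, v}} (μ : E.FinPath) : ℕ :=
  μ.edges.length

/-- An infinite path `x 0, x 1, x 2, …`. -/
@[ext]
structure InfPath (E : DirectedGraph.{u, v}) where
  edge : ℕ → E.Edge
  isPath : ∀ i, E.s (edge i) = E.r (edge (i + 1))

/-- The range of an infinite path. -/
def InfPath.range {E : DirectedGraph.{u, v}} (x : E.InfPath) : E.Vert :=
  E.r (x.edge 0)

/-- `x` is the concatenation `μ z` of a finite path `μ` and an infinite path `z`. -/
structure IsConcat {E : DirectedGraph.{u, v}} (μ : E.FinPath) (z x : E.InfPath) : Prop where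
  source_eq : z.range = μ.source
  range_eq : x.range = μ.range
  head : ∀ (i : ℕ) (hi : i < μ.edges.length), x.edge i = μ.edges[i]
  tail : ∀ i : ℕ, x.edge (μ.length + i) = z.edge i

/-- Shift equivalence with lag `k`: the edge `x (j + k)` equals `y j` for all large `j`. -/
def ShiftEquiv {E : DirectedGraph.{u, v}} (x : E.InfPath) (k : ℤ) (y : E.InfPath) : Prop :=
  ∃ m n : ℕ, k = (m : ℤ) - (n : ℤ) ∧ ∀ i : ℕ, x.edge (m + i) = y.edge (n + i)

theorem ShiftEquiv.refl {E : DirectedGraph.{u, v}} (x : E.InfPath) : ShiftEquiv x 0 x :=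
  ⟨0, 0, by simp, fun _ => rfl⟩

theorem ShiftEquiv.symm {E : DirectedGraph.{u, v}} {x y : E.InfPath} {k : ℤ}
    (h : ShiftEquiv x k y) : ShiftEquiv y (-k) x := by
  obtain ⟨m, n, hk, h⟩ := h
  exact ⟨n, m, by omega, fun i => (h i).symm⟩

theorem ShiftEquiv.trans {E : DirectedGraph.{u, v}} {x y z : E.InfPath} {k l : ℤ}
    (h : ShiftEquiv x k y) (h' : ShiftEquiv y l z) : ShiftEquiv x (k + l) z := by
  obtain ⟨m, n, hk, h⟩ := h
  obtain ⟨p, q, hl, h'⟩ := h'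
  refine ⟨m + p, q + n, by push_cast; omega, fun i => ?_⟩
  have h1 := h (p + i)
  have h2 := h' (n + i)
  rw [show m + p + i = m + (p + i) by omega, h1,
    show n + (p + i) = p + (n + i) by omega, h2, show q + (n + i) = q + n + i by omega]

/-! ### The graph groupoid -/

/-- The (morphisms of the) graph groupoid: triples `(x, k, y)` with `x` and `y` shift equivalent
with lag `k`. The objects are the infinite paths; `(x, k, y)` has range `x` and source `y`. -/
@[ext]
structure GraphGroupoid (E : DirectedGraph.{u, v}) where
  rng : E.InfPath
  lag : ℤ
  src : E.InfPath
  shiftEquiv : ShiftEquiv rng lag src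

namespace GraphGroupoid

variable {E : DirectedGraph.{u, v}}

/-- The product `(x, k, y) (y, l, z) = (x, k + l, z)` of composable elements. -/
def comp (g h : E.GraphGroupoid) (hc : g.src = h.rng) : E.GraphGroupoid where
  rng := g.rng
  lag := g.lag + h.lag
  src := h.src
  shiftEquiv := g.shiftEquiv.trans (hc ▸ h.shiftEquiv)

/-- The identity morphism `(x, 0, x)`. -/
def unit (x : E.InfPath) : E.GraphGroupoid where
  rng := x
  lag := 0
  src := x
  shiftEquiv := ShiftEquiv.refl x

/-- The inverse `(x, k, y)⁻¹ = (y, -k, x)`. -/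
def inv (g : E.GraphGroupoid) : E.GraphGroupoid where
  rng := g.src
  lag := -g.lag
  src := g.rng
  shiftEquiv := g.shiftEquiv.symm

theorem comp_assoc (g h k : E.GraphGroupoid) (h1 : g.src = h.rng) (h2 : h.src = k.rng) :
    (g.comp h h1).comp k h2 = g.comp (h.comp k h2) h1 := by
  ext1
  · rfl
  · exact add_assoc _ _ _
  · rfl

theorem unit_comp (g : E.GraphGroupoid) : (unit g.rng).comp g rfl = g := by
  ext1
  · rfl
  · exact zero_add _
  · rfl

theorem comp_unit (g : E.GraphGroupoid) : g.comp (unit g.src) rfl = g := by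
  ext1
  · rfl
  · exact add_zero _
  · rfl

theorem comp_inv (g : E.GraphGroupoid) : g.comp g.inv rfl = unit g.rng := by
  ext1
  · rfl
  · exact add_neg_cancel _
  · rfl

theorem inv_comp (g : E.GraphGroupoid) : g.inv.comp g rfl = unit g.src := by
  ext1
  · rfl
  · exact neg_add_cancel _
  · rfl

/-- The set `Z(μ, ν)` of all `(μ z, |μ| - |ν|, ν z)`. -/
def cylinder (μ ν : E.FinPath) : Set E.GraphGroupoid :=
  {g | g.lag = (μ.length : ℤ) - (ν.length : ℤ) ∧
    ∃ z : E.InfPath, IsConcat μ z g.rng ∧ IsConcat ν z g.src}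

/-- The topology with basis the sets `Z(μ, ν)`, where `s(μ) = s(ν)`. -/
instance : TopologicalSpace E.GraphGroupoid :=
  TopologicalSpace.generateFrom
    {U | ∃ μ ν : E.FinPath, μ.source = ν.source ∧ U = cylinder μ ν}

end GraphGroupoid

/-- An isomorphism of topological groupoids between graph groupoids: a homeomorphism such that
both it and its inverse carry composable pairs to composable pairs, and which is
multiplicative. -/
structure TopologicalGroupoidIso (E : DirectedGraph.{u, v}) (F : DirectedGraph.{u', v'}) where
  toHomeomorph : E.GraphGroupoid ≃ₜ F.GraphGroupoid
  composable_iff : ∀ g h : E.GraphGroupoid,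
    g.src = h.rng ↔ (toHomeomorph g).src = (toHomeomorph h).rng
  map_comp : ∀ (g h : E.GraphGroupoid) (hc : g.src = h.rng),
    toHomeomorph (g.comp h hc) =
      (toHomeomorph g).comp (toHomeomorph h) ((composable_iff g h).1 hc)

/-! ### Leavitt families and the Leavitt path algebra

Algebras are associative but need not have an identity. -/

/-- A Leavitt `E`-family in `A`; here `S' e` is the element attached to the ghost edge of `e`. -/
structure IsLeavittFamily (E : DirectedGraph.{u, v}) {A : Type w} [NonUnitalRing A]
    (P : E.Vert → A) (S S' : E.Edge → A) : Prop where
  idem : ∀ v, P v * P v = P v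
  orth : ∀ v v', v ≠ v' → P v * P v' = 0
  range_edge : ∀ e, P (E.r e) * S e = S e
  edge_source : ∀ e, S e * P (E.s e) = S e
  source_ghost : ∀ e, P (E.s e) * S' e = S' e
  ghost_range : ∀ e, S' e * P (E.r e) = S' e
  ghost_edge_self : ∀ e, S' e * S e = P (E.s e)
  ghost_edge_ne : ∀ e f, e ≠ f → S' e * S f = 0
  sum_eq : ∀ v (X : Finset E.Edge), X.Nonempty → (∀ e, e ∈ X ↔ E.r e = v) →
    P v = ∑ e ∈ X, S e * S' e

/-- Formal expressions in vertices, edges and ghost edges. -/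
inductive Expr (R : Type w) (E : DirectedGraph.{u, v}) : Type (max u v w)
  | vert (v : E.Vert)
  | edge (e : E.Edge)
  | ghost (e : E.Edge)
  | zero
  | add (a b : Expr R E)
  | mul (a b : Expr R E)
  | smul (t : R) (a : Expr R E)

namespace Expr

variable {R : Type w} [CommRing R] {E : DirectedGraph.{u, v}}

/-- The formal sum of `e e*` over a list of edges. -/
def sumEdges : List E.Edge → Expr R E
  | [] => zero
  | e :: l => add (mul (edge e) (ghost e)) (sumEdges l)

/-- The smallest congruence on formal expressions which makes them an associative `R`-algebra
containing a Leavitt `E`-family. -/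
inductive Rel : Expr R E → Expr R E → Prop
  -- an equivalence relation, compatible with the operations
  | refl (a) : Rel a a
  | symm {a b} : Rel a b → Rel b a
  | trans {a b c} : Rel a b → Rel b c → Rel a c
  | add_congr_left {a a'} (b) : Rel a a' → Rel (add a b) (add a' b)
  | add_congr_right (a) {b b'} : Rel b b' → Rel (add a b) (add a b')
  | mul_congr_left {a a'} (b) : Rel a a' → Rel (mul a b) (mul a' b)
  | mul_congr_right (a) {b b'} : Rel b b' → Rel (mul a b) (mul a b')
  | smul_congr (t) {a a'} : Rel a a' → Rel (smul t a) (smul t a')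
  -- the axioms of a (not necessarily unital) associative algebra
  | add_assoc (a b c) : Rel (add (add a b) c) (add a (add b c))
  | add_comm (a b) : Rel (add a b) (add b a)
  | zero_add (a) : Rel (add zero a) a
  | add_smul (t t' a) : Rel (smul (t + t') a) (add (smul t a) (smul t' a))
  | smul_add (t a b) : Rel (smul t (add a b)) (add (smul t a) (smul t b))
  | mul_smul (t t' a) : Rel (smul (t * t') a) (smul t (smul t' a))
  | one_smul (a) : Rel (smul 1 a) a
  | zero_smul (a) : Rel (smul 0 a) zero
  | smul_zero (t) : Rel (smul t zero) zero
  | mul_assoc (a b c) : Rel (mul (mul a b) c) (mul a (mul b c))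
  | mul_add (a b c) : Rel (mul a (add b c)) (add (mul a b) (mul a c))
  | add_mul (a b c) : Rel (mul (add a b) c) (add (mul a c) (mul b c))
  | zero_mul (a) : Rel (mul zero a) zero
  | mul_zero (a) : Rel (mul a zero) zero
  | smul_mul (t a b) : Rel (mul (smul t a) b) (smul t (mul a b))
  | mul_smul_comm (t a b) : Rel (mul a (smul t b)) (smul t (mul a b))
  -- the relations of a Leavitt family
  | idem (v) : Rel (mul (vert v) (vert v)) (vert v)
  | orth (v v') : v ≠ v' → Rel (mul (vert v) (vert v')) zero
  | range_edge (e) : Rel (mul (vert (E.r e)) (edge e)) (edge e)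
  | edge_source (e) : Rel (mul (edge e) (vert (E.s e))) (edge e)
  | source_ghost (e) : Rel (mul (vert (E.s e)) (ghost e)) (ghost e)
  | ghost_range (e) : Rel (mul (ghost e) (vert (E.r e))) (ghost e)
  | ghost_edge_self (e) : Rel (mul (ghost e) (edge e)) (vert (E.s e))
  | ghost_edge_ne (e f) : e ≠ f → Rel (mul (ghost e) (edge f)) zero
  | sum_eq (v) (l : List E.Edge) : l ≠ [] → l.Nodup → (∀ e, e ∈ l ↔ E.r e = v) →
      Rel (vert v) (sumEdges l)

/-- The formal involution: it swaps `e` and `e*`, reverses products and conjugates scalars. -/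
def starExpr [StarRing R] : Expr R E → Expr R E
  | vert v => vert v
  | edge e => ghost e
  | ghost e => edge e
  | zero => zero
  | add a b => add (starExpr a) (starExpr b)
  | mul a b => mul (starExpr b) (starExpr a)
  | smul t a => smul (star t) (starExpr a)

theorem starExpr_starExpr [StarRing R] (a : Expr R E) : starExpr (starExpr a) = a := by
  induction a <;> simp_all [starExpr]

theorem starExpr_sumEdges [StarRing R] (l : List E.Edge) :
    starExpr (sumEdges l : Expr R E) = sumEdges l := by
  induction l <;> simp_all [starExpr, sumEdges]

theorem Rel.starExpr [StarRing R] {a b : Expr R E} (h : Rel a b) :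
    Rel a.starExpr b.starExpr := by
  induction h with
  | refl a => exact .refl _
  | symm _ ih => exact .symm ih
  | trans _ _ ih ih' => exact .trans ih ih'
  | add_congr_left b _ ih => exact .add_congr_left _ ih
  | add_congr_right a _ ih => exact .add_congr_right _ ih
  | mul_congr_left b _ ih => exact .mul_congr_right _ ih
  | mul_congr_right a _ ih => exact .mul_congr_left _ ih
  | smul_congr t _ ih => exact .smul_congr _ ih
  | add_assoc a b c => exact .add_assoc _ _ _
  | add_comm a b => exact .add_comm _ _
  | zero_add a => exact .zero_add _
  | add_smul t t' a => simpa only [Expr.starExpr, star_add] using .add_smul _ _ _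
  | smul_add t a b => exact .smul_add _ _ _
  | mul_smul t t' a =>
    simpa only [Expr.starExpr, star_mul, mul_comm (star t')] using .mul_smul _ _ _
  | one_smul a => simpa only [Expr.starExpr, star_one] using .one_smul _
  | zero_smul a => simpa only [Expr.starExpr, star_zero] using .zero_smul _
  | smul_zero t => exact .smul_zero _
  | mul_assoc a b c => exact .symm (.mul_assoc _ _ _)
  | mul_add a b c => exact .add_mul _ _ _
  | add_mul a b c => exact .mul_add _ _ _
  | zero_mul a => exact .mul_zero _
  | mul_zero a => exact .zero_mul _
  | smul_mul t a b => exact .mul_smul_comm _ _ _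
  | mul_smul_comm t a b => exact .smul_mul _ _ _
  | idem v => exact .idem _
  | orth v v' h => exact .orth _ _ h.symm
  | range_edge e => exact .ghost_range _
  | edge_source e => exact .source_ghost _
  | source_ghost e => exact .edge_source _
  | ghost_range e => exact .range_edge _
  | ghost_edge_self e => exact .ghost_edge_self _
  | ghost_edge_ne e f h => exact .ghost_edge_ne _ _ h.symm
  | sum_eq v l h0 hn hl => rw [starExpr_sumEdges]; exact .sum_eq _ _ h0 hn hl

/-- The value of a formal expression in an algebra, given the values of the generators. -/
def eval {A : Type w'} [NonUnitalRing A] [Module R A] (P : E.Vert → A) (S S' : E.Edge → A) :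
    Expr R E → A
  | vert v => P v
  | edge e => S e
  | ghost e => S' e
  | zero => 0
  | add a b => eval P S S' a + eval P S S' b
  | mul a b => eval P S S' a * eval P S S' b
  | smul t a => t • eval P S S' a

theorem eval_sumEdges {A : Type w'} [NonUnitalRing A] [Module R A]
    (P : E.Vert → A) (S S' : E.Edge → A) (l : List E.Edge) :
    eval P S S' (sumEdges l : Expr R E) = (l.map fun e => S e * S' e).sum := by
  induction l <;> simp_all [eval, sumEdges]

theorem Rel.eval_eq {A : Type w'} [NonUnitalRing A] [Module R A] [IsScalarTower R A A]
    [SMulCommClass R A A] {P : E.Vert → A} {S S' : E.Edge → A}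
    (hF : E.IsLeavittFamily P S S') {a b : Expr R E} (h : Rel a b) :
    eval P S S' a = eval P S S' b := by
  classical
  induction h with
  | sum_eq v l h0 hn hl =>
    rw [eval_sumEdges]
    refine (hF.sum_eq v l.toFinset (by simpa using h0) (by simpa using hl)).trans ?_
    exact (List.sum_toFinset _ hn)
  | orth v v' h => exact hF.orth _ _ h
  | ghost_edge_ne e f h => exact hF.ghost_edge_ne _ _ h
  | trans _ _ ih ih' => exact ih.trans ih'
  | symm _ ih => exact ih.symm
  | _ => simp_all [eval, hF.idem, hF.range_edge, hF.edge_source, hF.source_ghost,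
      hF.ghost_range, hF.ghost_edge_self, _root_.add_assoc, _root_.add_comm, _root_.add_smul,
      SemigroupAction.mul_smul, _root_.mul_assoc, _root_.mul_add, _root_.add_mul,
      _root_.smul_mul_assoc, _root_.mul_smul_comm]

end Expr

/-- The Leavitt path algebra `L_R(E)`: the universal (not necessarily unital) associative
`R`-algebra generated by a Leavitt `E`-family. -/
def LeavittPathAlgebra (R : Type w) [CommRing R] (E : DirectedGraph.{u, v}) :
    Type (max u v w) :=
  Quot (Expr.Rel (R := R) (E := E))

namespace LeavittPathAlgebra

variable (R : Type w) [CommRing R] (E : DirectedGraph.{u, v})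

variable {R E} in
/-- The class of a formal expression. -/
def mk (a : Expr R E) : LeavittPathAlgebra R E := Quot.mk _ a

/-- The generator `p_v`. -/
def p (v : E.Vert) : LeavittPathAlgebra R E := mk (.vert v)

/-- The generator `s_e`. -/
def se (e : E.Edge) : LeavittPathAlgebra R E := mk (.edge e)

/-- The generator `s_{e*}`. -/
def ghost (e : E.Edge) : LeavittPathAlgebra R E := mk (.ghost e)

variable {R E}

instance : Zero (LeavittPathAlgebra R E) := ⟨mk .zero⟩

instance : Add (LeavittPathAlgebra R E) :=
  ⟨Quot.map₂ .add (fun a _ _ h => .add_congr_right a h) (fun _ _ b h => .add_congr_left b h)⟩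

instance : Mul (LeavittPathAlgebra R E) :=
  ⟨Quot.map₂ .mul (fun a _ _ h => .mul_congr_right a h) (fun _ _ b h => .mul_congr_left b h)⟩

instance : SMul R (LeavittPathAlgebra R E) :=
  ⟨fun t => Quot.map (.smul t) (fun _ _ h => .smul_congr t h)⟩

instance : Neg (LeavittPathAlgebra R E) := ⟨fun a => (-1 : R) • a⟩

instance : NonUnitalRing (LeavittPathAlgebra R E) where
  add_assoc := by rintro ⟨a⟩ ⟨b⟩ ⟨c⟩; exact Quot.sound (.add_assoc a b c)
  add_comm := by rintro ⟨a⟩ ⟨b⟩; exact Quot.sound (.add_comm a b)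
  zero_add := by rintro ⟨a⟩; exact Quot.sound (.zero_add a)
  add_zero := by
    rintro ⟨a⟩; exact Quot.sound (.trans (.add_comm a .zero) (.zero_add a))
  nsmul := nsmulRec
  zsmul := zsmulRec
  neg_add_cancel := by
    rintro ⟨a⟩
    refine Quot.sound (.trans (.add_congr_right _ (.symm (.one_smul a))) ?_)
    refine .trans (.symm (.add_smul _ _ _)) ?_
    rw [neg_add_cancel]
    exact .zero_smul a
  mul_assoc := by rintro ⟨a⟩ ⟨b⟩ ⟨c⟩; exact Quot.sound (.mul_assoc a b c)
  left_distrib := by rintro ⟨a⟩ ⟨b⟩ ⟨c⟩; exact Quot.sound (.mul_add a b c)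
  right_distrib := by rintro ⟨a⟩ ⟨b⟩ ⟨c⟩; exact Quot.sound (.add_mul a b c)
  zero_mul := by rintro ⟨a⟩; exact Quot.sound (.zero_mul a)
  mul_zero := by rintro ⟨a⟩; exact Quot.sound (.mul_zero a)

instance : Module R (LeavittPathAlgebra R E) where
  one_smul := by rintro ⟨a⟩; exact Quot.sound (.one_smul a)
  mul_smul := by rintro t t' ⟨a⟩; exact Quot.sound (.mul_smul t t' a)
  smul_zero := fun t => Quot.sound (.smul_zero t)
  smul_add := by rintro t ⟨a⟩ ⟨b⟩; exact Quot.sound (.smul_add t a b)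
  add_smul := by rintro t t' ⟨a⟩; exact Quot.sound (.add_smul t t' a)
  zero_smul := by rintro ⟨a⟩; exact Quot.sound (.zero_smul a)

instance : IsScalarTower R (LeavittPathAlgebra R E) (LeavittPathAlgebra R E) where
  smul_assoc := by rintro t ⟨a⟩ ⟨b⟩; exact Quot.sound (.smul_mul t a b)

instance : SMulCommClass R (LeavittPathAlgebra R E) (LeavittPathAlgebra R E) where
  smul_comm := by rintro t ⟨a⟩ ⟨b⟩; exact Quot.sound (.symm (.mul_smul_comm t a b))

/-- The involution, for which `∑ t s_μ s_ν*` has the image `∑ (star t) s_ν s_μ*`. -/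
instance [StarRing R] : StarRing (LeavittPathAlgebra R E) where
  star := Quot.map Expr.starExpr fun _ _ h => h.starExpr
  star_involutive := by
    rintro ⟨a⟩; exact congrArg (Quot.mk _) a.starExpr_starExpr
  star_mul := by rintro ⟨a⟩ ⟨b⟩; rfl
  star_add := by rintro ⟨a⟩ ⟨b⟩; rfl

instance [StarRing R] : StarModule R (LeavittPathAlgebra R E) where
  star_smul := by rintro t ⟨a⟩; rfl

theorem star_p [StarRing R] (v : E.Vert) : star (p R E v) = p R E v := rfl

theorem star_se [StarRing R] (e : E.Edge) : star (se R E e) = ghost R E e := rfl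

theorem mk_sumEdges (l : List E.Edge) :
    (mk (Expr.sumEdges l) : LeavittPathAlgebra R E) =
      (l.map fun e => se R E e * ghost R E e).sum := by
  induction l with
  | nil => rfl
  | cons e l ih => rw [List.map_cons, List.sum_cons, ← ih]; rfl

variable (R E) in
theorem isLeavittFamily : E.IsLeavittFamily (p R E) (se R E) (ghost R E) where
  idem v := Quot.sound (.idem v)
  orth v v' h := Quot.sound (.orth v v' h)
  range_edge e := Quot.sound (.range_edge e)
  edge_source e := Quot.sound (.edge_source e)
  source_ghost e := Quot.sound (.source_ghost e)
  ghost_range e := Quot.sound (.ghost_range e)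
  ghost_edge_self e := Quot.sound (.ghost_edge_self e)
  ghost_edge_ne e f h := Quot.sound (.ghost_edge_ne e f h)
  sum_eq v X h0 hX := by
    rw [← Finset.sum_map_toList, ← mk_sumEdges]
    exact Quot.sound (.sum_eq v X.toList (by simpa using h0.ne_empty) X.nodup_toList
      (by simpa using hX))

/-- The universal property. -/
theorem existsUnique_hom {A : Type w'} [NonUnitalRing A] [Module R A] [IsScalarTower R A A]
    [SMulCommClass R A A] {P : E.Vert → A} {S S' : E.Edge → A}
    (hF : E.IsLeavittFamily P S S') :
    ∃! φ : LeavittPathAlgebra R E →ₙₐ[R] A,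
      (∀ v, φ (p R E v) = P v) ∧ (∀ e, φ (se R E e) = S e) ∧ ∀ e, φ (ghost R E e) = S' e := by
  refine ⟨{ toFun := Quot.lift (Expr.eval P S S') fun _ _ h => h.eval_eq hF
            map_smul' := by rintro t ⟨a⟩; rfl
            map_zero' := rfl
            map_add' := by rintro ⟨a⟩ ⟨b⟩; rfl
            map_mul' := by rintro ⟨a⟩ ⟨b⟩; rfl },
    ⟨fun _ => rfl, fun _ => rfl, fun _ => rfl⟩, ?_⟩
  rintro ψ ⟨h1, h2, h3⟩
  ext ⟨a⟩
  change ψ (mk a) = Expr.eval P S S' a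
  induction a with
  | vert v => exact h1 v
  | edge e => exact h2 e
  | ghost e => exact h3 e
  | zero => exact map_zero ψ
  | add a b iha ihb => exact (map_add ψ (mk a) (mk b)).trans (by rw [iha, ihb]; rfl)
  | mul a b iha ihb => exact (map_mul ψ (mk a) (mk b)).trans (by rw [iha, ihb]; rfl)
  | smul t a ih => exact (map_smul ψ t (mk a)).trans (by rw [ih]; rfl)

variable (R) in
/-- The product of the generators along a path with range `v`; it ends in `p_w`, where `w` is the
source of the path, which changes nothing for a path of positive length. -/
def pathProd : E.Vert → List E.Edge → LeavittPathAlgebra R E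
  | v, [] => p R E v
  | _, e :: l => se R E e * pathProd (E.s e) l

variable (R) in
/-- The element `s_μ` attached to a finite path `μ`. -/
def sPath (μ : E.FinPath) : LeavittPathAlgebra R E := pathProd R μ.range μ.edges

variable (R E) in
/-- The diagonal `D(E)`: the `R`-linear span of all `s_μ s_μ*`. -/
def diagonal [StarRing R] : Submodule R (LeavittPathAlgebra R E) :=
  Submodule.span R {a | ∃ μ : E.FinPath, a = sPath R μ * star (sPath R μ)}

end LeavittPathAlgebra
end DirectedGraph

/-!
The proof reads both algebras as algebras of functions on the groupoids. The Leavitt path algebra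
acts on the free module with basis `E^∞ × ℤ` (`pathRep`), and `ev a g` is the matrix coefficient
of `a` which belongs to the groupoid element `g`. In this picture `s_μ s_ν*` is the indicator
function of `Z(μ, ν)` (`ev_matUnit`), the product is convolution (`ev_mul`), the involution is
`a*(g) = star (a(g⁻¹))` (`ev_star`), an element is determined by its function (`ev_injective`),
and the diagonal consists of the functions supported on the units (`mem_diagonal_iff`). For the
last two facts one writes an element with all `ν` of the same length, so that the sets `Z(μ, ν)`
which occur are disjoint (`exists_normalForm`).

*From groupoids to algebras.* All of this structure is intrinsic to the groupoid, so it only has to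
be seen that transport along a groupoid isomorphism `Φ` preserves the functions which come from the
algebras. By a compactness argument (`cylinder_induction`, a form of König's lemma) the indicator
functions of the sets `Φ(Z(μ, ν))` do.

*From algebras to groupoids.* Over an integral domain, the normalizers of the diagonal are functions
whose support meets each source and each range fibre in at most one point
(`IsNormalizer.eq_of_src`, `IsNormalizer.eq_of_rng`): the support of `n d n*` would otherwise
contain a product `a b⁻¹` of an element of maximal and an element of minimal lag which is not a
unit. A diagonal-preserving `*`-isomorphism `π` maps normalizers to normalizers. The point `y`
corresponds to `x` if `d(x) ≠ 0 ↔ π(d)(y) ≠ 0` for all `d` in the diagonal, and the groupoid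
element `h` corresponds to `g` if `n(g) ≠ 0 ↔ π(n)(h) ≠ 0` for all normalizers `n`. Both relations
are symmetric under `π ↦ π⁻¹`, so existence of counterparts (`exists_pointRel`,
`exists_groupoidRel`) and their uniqueness give bijections; only vanishing is compared, therefore
`π` need not be linear. The bijection of the groupoids is multiplicative, since products of
normalizers are computed pointwise, and continuous, since supports are open.
-/

namespace DirectedGraph

variable {E : DirectedGraph.{u, v}}

/-! ### Finite and infinite paths -/

theorem FinPath.ext {μ ν : E.FinPath} (h₁ : μ.range = ν.range) (h₂ : μ.edges = ν.edges) :
    μ = ν := by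
  cases μ; cases ν; cases h₁; cases h₂; rfl

theorem isPathFrom_concat {v : E.Vert} {l : List E.Edge} {e : E.Edge} (hl : E.IsPathFrom v l)
    (he : E.r e = E.sourceFrom v l) : E.IsPathFrom v (l ++ [e]) := by
  induction l generalizing v with
  | nil => exact ⟨he, trivial⟩
  | cons f l ih => exact ⟨hl.1, ih hl.2 he⟩

theorem sourceFrom_concat (v : E.Vert) (l : List E.Edge) (e : E.Edge) :
    E.sourceFrom v (l ++ [e]) = E.s e := by
  induction l generalizing v with
  | nil => rfl
  | cons f l ih => exact ih _

/-- The path of length `0` at a vertex. -/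
def FinPath.nil (v : E.Vert) : E.FinPath := ⟨v, [], trivial⟩

/-- The path `e μ`. -/
def FinPath.cons (e : E.Edge) (μ : E.FinPath) (h : E.s e = μ.range) : E.FinPath :=
  ⟨E.r e, e :: μ.edges, rfl, h ▸ μ.isPath⟩

/-- The path `μ e`. -/
def FinPath.snoc (μ : E.FinPath) (e : E.Edge) (h : E.r e = μ.source) : E.FinPath :=
  ⟨μ.range, μ.edges ++ [e], isPathFrom_concat μ.isPath h⟩

@[simp] theorem FinPath.length_snoc (μ : E.FinPath) (e : E.Edge) (h : E.r e = μ.source) :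
    (μ.snoc e h).length = μ.length + 1 := by
  simp [FinPath.snoc, FinPath.length]

@[simp] theorem FinPath.source_snoc (μ : E.FinPath) (e : E.Edge) (h : E.r e = μ.source) :
    (μ.snoc e h).source = E.s e :=
  sourceFrom_concat _ _ _

theorem FinPath.snoc_congr {μ ν : E.FinPath} {e f : E.Edge} {h : E.r e = μ.source}
    {h' : E.r f = ν.source} (h₁ : μ = ν) (h₂ : e = f) : μ.snoc e h = ν.snoc f h' := by
  subst h₁ h₂
  rfl

theorem FinPath.source_cons (e : E.Edge) (μ : E.FinPath) (h : E.s e = μ.range) :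
    (FinPath.cons e μ h).source = μ.source := by
  change E.sourceFrom (E.s e) μ.edges = E.sourceFrom μ.range μ.edges
  rw [h]

namespace InfPath

/-- The infinite path `e z`. -/
def cons (e : E.Edge) (z : E.InfPath) (h : z.range = E.s e) : E.InfPath where
  edge i := Nat.casesOn i e z.edge
  isPath i := by
    cases i with
    | zero => exact h.symm
    | succ i => exact z.isPath i

/-- The infinite path without its first `n` edges. -/
def drop (x : E.InfPath) (n : ℕ) : E.InfPath where
  edge i := x.edge (n + i)
  isPath i := x.isPath (n + i)

theorem isPathFrom_map (x : E.InfPath) (n : ℕ) :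
    E.IsPathFrom x.range ((List.range n).map x.edge) ∧
      E.sourceFrom x.range ((List.range n).map x.edge) = E.r (x.edge n) := by
  induction n with
  | zero => exact ⟨trivial, rfl⟩
  | succ n ih =>
    rw [List.range_succ, List.map_append, List.map_singleton, sourceFrom_concat]
    exact ⟨isPathFrom_concat ih.1 ih.2.symm, x.isPath n⟩

/-- The path consisting of the first `n` edges of an infinite path. -/
def take (x : E.InfPath) (n : ℕ) : E.FinPath :=
  ⟨x.range, (List.range n).map x.edge, (x.isPathFrom_map n).1⟩

@[simp] theorem length_take (x : E.InfPath) (n : ℕ) : (x.take n).length = n := by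
  simp [take, FinPath.length]

theorem source_take (x : E.InfPath) (n : ℕ) : (x.take n).source = E.r (x.edge n) :=
  (x.isPathFrom_map n).2

theorem range_drop (x : E.InfPath) (n : ℕ) : (x.drop n).range = (x.take n).source :=
  (x.source_take n).symm

theorem take_succ (x : E.InfPath) (n : ℕ) :
    x.take (n + 1) = (x.take n).snoc (x.edge n) (x.source_take n).symm :=
  FinPath.ext rfl (by simp [take, FinPath.snoc, List.range_succ])

theorem take_eq_take_iff {x y : E.InfPath} {n : ℕ} :
    x.take n = y.take n ↔ x.range = y.range ∧ ∀ i < n, x.edge i = y.edge i := by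
  constructor
  · intro h
    refine ⟨congrArg FinPath.range h, fun i hi => ?_⟩
    have h2 : (List.range n).map x.edge = (List.range n).map y.edge := congrArg FinPath.edges h
    exact List.map_inj_left.1 h2 i (List.mem_range.2 hi)
  · rintro ⟨h1, h2⟩
    exact FinPath.ext h1 (List.map_inj_left.2 fun i hi => h2 i (List.mem_range.1 hi))

theorem take_eq_take_of_le {x y : E.InfPath} {m n : ℕ} (hmn : m ≤ n) (h : x.take n = y.take n) :
    x.take m = y.take m := by
  rw [take_eq_take_iff] at h ⊢
  exact ⟨h.1, fun i hi => h.2 i (by omega)⟩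

theorem ext_of_take {x y : E.InfPath} (h : ∀ n, x.take n = y.take n) : x = y := by
  ext i
  exact (take_eq_take_iff.1 (h (i + 1))).2 i (by omega)

theorem exists_take_ne {x y : E.InfPath} (h : x ≠ y) :
    ∃ N, ∀ n, N ≤ n → x.take n ≠ y.take n := by
  by_contra! hc
  exact h (ext_of_take fun n => by
    obtain ⟨m, hm, h'⟩ := hc n
    exact take_eq_take_of_le hm h')

theorem ext_take_drop {x y : E.InfPath} {n : ℕ} (h : x.take n = y.take n)
    (h' : x.drop n = y.drop n) : x = y := by
  ext i
  rcases lt_or_ge i n with hi | hi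
  · exact (take_eq_take_iff.1 h).2 i hi
  · obtain ⟨j, rfl⟩ := Nat.exists_eq_add_of_le hi
    exact congrFun (congrArg InfPath.edge h') j

theorem drop_drop (x : E.InfPath) (m n : ℕ) : (x.drop m).drop n = x.drop (m + n) := by
  ext i
  exact congrArg x.edge (add_assoc m n i).symm

theorem take_cons (e : E.Edge) (z : E.InfPath) (h : z.range = E.s e) (n : ℕ) :
    (z.cons e h).take (n + 1) = (z.take n).cons e h.symm :=
  FinPath.ext rfl (by
    simp only [take, FinPath.cons, List.range_succ_eq_map, List.map_cons, List.map_map]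
    rfl)

theorem range_drop_one (x : E.InfPath) : (x.drop 1).range = E.s (x.edge 0) :=
  (x.isPath 0).symm

theorem cons_drop_one {x : E.InfPath} {e : E.Edge} (h : (x.drop 1).range = E.s e)
    (he : x.edge 0 = e) : (x.drop 1).cons e h = x := by
  ext i
  cases i with
  | zero => exact he.symm
  | succ i => exact congrArg x.edge (add_comm 1 i)

theorem drop_one_cons {z : E.InfPath} {e : E.Edge} (h : z.range = E.s e) :
    (z.cons e h).drop 1 = z := by
  ext i
  change (z.cons e h).edge (1 + i) = _
  rw [add_comm]
  rfl

end InfPath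

theorem exists_concat (μ : E.FinPath) (z : E.InfPath) (h : z.range = μ.source) :
    ∃ x : E.InfPath, x.take μ.length = μ ∧ x.drop μ.length = z := by
  obtain ⟨v, l, hl⟩ := μ
  induction l generalizing v with
  | nil =>
    refine ⟨z, FinPath.ext h rfl, ?_⟩
    ext i
    exact congrArg z.edge (zero_add i)
  | cons e l ih =>
    obtain ⟨x, hx, hx'⟩ := ih (E.s e) hl.2 h
    have hr : x.range = E.s e := congrArg FinPath.range hx
    refine ⟨x.cons e hr, ?_, ?_⟩
    · have h1 := InfPath.take_cons e x hr l.length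
      refine h1.trans (FinPath.ext hl.1 ?_)
      exact congrArg (fun μ : E.FinPath => e :: μ.edges) hx
    · rw [← hx']
      ext i
      change (x.cons e hr).edge (l.length + 1 + i) = x.edge (l.length + i)
      rw [show l.length + 1 + i = (l.length + i) + 1 by omega]
      rfl

theorem isConcat_iff {μ : E.FinPath} {z x : E.InfPath} :
    IsConcat μ z x ↔ x.take μ.length = μ ∧ x.drop μ.length = z := by
  constructor
  · intro h
    refine ⟨FinPath.ext h.range_eq (List.ext_getElem ?_ fun i h1 h2 => ?_), ?_⟩
    · exact x.length_take _
    · simpa [InfPath.take] using h.head i h2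
    · ext i
      exact h.tail i
  · rintro ⟨h1, rfl⟩
    refine ⟨(x.range_drop _).trans (congrArg FinPath.source h1), congrArg FinPath.range h1,
      fun i hi => ?_, fun i => rfl⟩
    have h2 : (List.range μ.length).map x.edge = μ.edges := congrArg FinPath.edges h1
    simp only [← h2, List.getElem_map, List.getElem_range]

/-- Without sources, every vertex is the range of an infinite path. -/
theorem NoSources.exists_infPath (hE : E.NoSources) (v : E.Vert) :
    ∃ z : E.InfPath, z.range = v := by
  choose f hf using hE
  let g : ℕ → E.Edge := fun n => Nat.rec (f v) (fun _ e => f (E.s e)) n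
  exact ⟨⟨g, fun i => (hf (E.s (g i))).symm⟩, hf v⟩

/-- König's lemma: a property of finite paths which holds for `μ`, and which some edge always
allows to prolong, holds along an infinite path that extends `μ`. -/
theorem exists_infPath_of_extend (Q : E.FinPath → Prop)
    (hQ : ∀ μ, Q μ → ∃ (e : E.Edge) (h : E.r e = μ.source), Q (μ.snoc e h))
    (μ : E.FinPath) (hμ : Q μ) :
    ∃ x : E.InfPath, x.take μ.length = μ ∧ ∀ n, Q (x.take (μ.length + n)) := by
  choose f hf hf' using hQ
  let g : ℕ → {μ // Q μ} := fun n =>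
    Nat.rec ⟨μ, hμ⟩ (fun _ ν => ⟨ν.1.snoc (f ν.1 ν.2) (hf _ _), hf' _ _⟩) n
  have hg : ∀ n, (g (n + 1)).1 = (g n).1.snoc (f (g n).1 (g n).2) (hf _ _) := fun n => rfl
  let z : E.InfPath := ⟨fun n => f (g n).1 (g n).2, fun i => by
    rw [hf (g (i + 1)).1 (g (i + 1)).2, hg, FinPath.source_snoc]⟩
  obtain ⟨x, hx, hx'⟩ := exists_concat μ z (hf μ hμ)
  have key : ∀ n, x.take (μ.length + n) = (g n).1 := by
    intro n
    induction n with
    | zero => exact hx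
    | succ n ih =>
      have he : x.edge (μ.length + n) = f (g n).1 (g n).2 :=
        congrFun (congrArg InfPath.edge hx') n
      rw [← add_assoc, InfPath.take_succ, hg]
      exact FinPath.snoc_congr ih he
  exact ⟨x, hx, fun n => by rw [key]; exact (g n).2⟩

/-! ### Groupoid identities -/

namespace GraphGroupoid

theorem inv_of_inv (g : E.GraphGroupoid) : g.inv.inv = g :=
  GraphGroupoid.ext rfl (neg_neg _) rfl

theorem comp_congr {g g' h h' : E.GraphGroupoid} (hg : g = g') (hh : h = h')
    (hc : g.src = h.rng) (hc' : g'.src = h'.rng) : g.comp h hc = g'.comp h' hc' := by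
  subst hg hh
  rfl

theorem eq_unit_of_comp_self {g : E.GraphGroupoid} (hc : g.src = g.rng)
    (h : g.comp g hc = g) : g = unit g.src := by
  have h1 : g.lag + g.lag = g.lag := congrArg GraphGroupoid.lag h
  exact GraphGroupoid.ext hc.symm (by change g.lag = 0; omega) rfl

theorem eq_inv_of_comp_eq_unit {g h : E.GraphGroupoid} (hc : g.src = h.rng) (x : E.InfPath)
    (he : g.comp h hc = unit x) : h = g.inv := by
  have h1 : g.rng = x := congrArg GraphGroupoid.rng he
  have h2 : g.lag + h.lag = 0 := congrArg GraphGroupoid.lag he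
  have h3 : h.src = x := congrArg GraphGroupoid.src he
  exact GraphGroupoid.ext hc.symm (by change h.lag = -g.lag; omega) (h3.trans h1.symm)

/-! ### Cylinder sets of the graph groupoid -/

theorem mem_cylinder {μ ν : E.FinPath} {g : E.GraphGroupoid} :
    g ∈ cylinder μ ν ↔ g.lag = (μ.length : ℤ) - ν.length ∧ g.rng.take μ.length = μ ∧
      g.src.take ν.length = ν ∧ g.rng.drop μ.length = g.src.drop ν.length := by
  simp only [cylinder, Set.mem_ofPred_eq, isConcat_iff]
  constructor
  · rintro ⟨h, z, ⟨h1, h2⟩, h3, h4⟩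
    exact ⟨h, h1, h3, h2.trans h4.symm⟩
  · rintro ⟨h, h1, h2, h3⟩
    exact ⟨h, _, ⟨h1, h3⟩, h2, rfl⟩

theorem source_eq_of_mem {μ ν : E.FinPath} {g : E.GraphGroupoid} (h : g ∈ cylinder μ ν) :
    μ.source = ν.source := by
  obtain ⟨-, h1, h2, h3⟩ := mem_cylinder.1 h
  rw [← h1, ← h2, ← InfPath.range_drop, ← InfPath.range_drop, h3]

theorem exists_mem_cylinder {μ ν : E.FinPath} (h : μ.source = ν.source) (z : E.InfPath)
    (hz : z.range = ν.source) : ∃ g ∈ cylinder μ ν, g.src.drop ν.length = z := by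
  obtain ⟨x, hx, hx'⟩ := exists_concat μ z (hz.trans h.symm)
  obtain ⟨y, hy, hy'⟩ := exists_concat ν z hz
  refine ⟨⟨x, μ.length - ν.length, y, μ.length, ν.length, rfl, fun i => ?_⟩, ?_, hy'⟩
  · exact congrFun (congrArg InfPath.edge (hx'.trans hy'.symm)) i
  · exact mem_cylinder.2 ⟨rfl, hx, hy, hx'.trans hy'.symm⟩

/-- A groupoid element with given source in a cylinder set is unique. -/
theorem eq_of_mem_cylinder_of_src {μ ν : E.FinPath} {g h : E.GraphGroupoid}
    (hg : g ∈ cylinder μ ν) (hh : h ∈ cylinder μ ν) (hs : g.src = h.src) : g = h := by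
  rw [mem_cylinder] at hg hh
  refine GraphGroupoid.ext ?_ (hg.1.trans hh.1.symm) hs
  exact InfPath.ext_take_drop (hg.2.1.trans hh.2.1.symm)
    (by rw [hg.2.2.2, hh.2.2.2, hs])

theorem inv_mem_cylinder {μ ν : E.FinPath} {g : E.GraphGroupoid} :
    g.inv ∈ cylinder μ ν ↔ g ∈ cylinder ν μ := by
  simp only [mem_cylinder, inv]
  constructor <;> rintro ⟨h, h1, h2, h3⟩ <;> exact ⟨by omega, h2, h1, h3.symm⟩

theorem unit_mem_cylinder {μ : E.FinPath} {x : E.InfPath} :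
    unit x ∈ cylinder μ μ ↔ x.take μ.length = μ := by
  simp [mem_cylinder, unit]

/-- Different cylinder sets `Z(μ, ν)` with `ν` of the same length are disjoint. -/
theorem cylinder_unique {μ ν μ' ν' : E.FinPath} {g : E.GraphGroupoid} (h : g ∈ cylinder μ ν)
    (h' : g ∈ cylinder μ' ν') (hl : ν.length = ν'.length) : μ = μ' ∧ ν = ν' := by
  rw [mem_cylinder] at h h'
  have hl' : μ.length = μ'.length := by omega
  exact ⟨by rw [← h.2.1, ← h'.2.1, hl'], by rw [← h.2.2.1, ← h'.2.2.1, hl]⟩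

/-- A cylinder set either contains or misses a cylinder set given by longer paths. -/
theorem mem_cylinder_of_le {α β μ ν : E.FinPath} {f g : E.GraphGroupoid}
    (hf : f ∈ cylinder α β) (hg : g ∈ cylinder α β) (hl : ν.length ≤ β.length)
    (h : f ∈ cylinder μ ν) : g ∈ cylinder μ ν := by
  rw [mem_cylinder] at hf hg h ⊢
  have hl' : μ.length ≤ α.length := by omega
  have h1 : f.rng.take α.length = g.rng.take α.length := hf.2.1.trans hg.2.1.symm
  have h2 : f.src.take β.length = g.src.take β.length := hf.2.2.1.trans hg.2.2.1.symm
  refine ⟨by omega, ?_, ?_, ?_⟩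
  · rw [← InfPath.take_eq_take_of_le hl' h1, h.2.1]
  · rw [← InfPath.take_eq_take_of_le hl h2, h.2.2.1]
  · ext i
    rcases lt_or_ge (μ.length + i) α.length with hi | hi
    · have h3 := (InfPath.take_eq_take_iff.1 h1).2 _ hi
      have h4 := (InfPath.take_eq_take_iff.1 h2).2 (ν.length + i) (by omega)
      have h5 := congrFun (congrArg InfPath.edge h.2.2.2) i
      exact h3.symm.trans (h5.trans h4)
    · have h5 := congrFun (congrArg InfPath.edge hg.2.2.2) (μ.length + i - α.length)
      change g.rng.edge (α.length + _) = g.src.edge (β.length + _) at h5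
      change g.rng.edge _ = g.src.edge _
      rwa [show α.length + (μ.length + i - α.length) = μ.length + i by omega,
        show β.length + (μ.length + i - α.length) = ν.length + i by omega] at h5

/-- Elements of `Z(μ, ν)` belong to the cylinder sets given by their own longer initial segments. -/
theorem mem_cylinder_take {μ ν : E.FinPath} {g : E.GraphGroupoid} (hg : g ∈ cylinder μ ν)
    (j : ℕ) : g ∈ cylinder (g.rng.take (μ.length + j)) (g.src.take (ν.length + j)) := by
  rw [mem_cylinder] at hg ⊢
  simp only [InfPath.length_take, true_and]
  refine ⟨by push_cast; omega, ?_⟩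
  rw [← InfPath.drop_drop, hg.2.2.2, InfPath.drop_drop]

theorem exists_cylinder (g : E.GraphGroupoid) : ∃ μ ν : E.FinPath, g ∈ cylinder μ ν := by
  obtain ⟨m, n, hk, h⟩ := g.shiftEquiv
  refine ⟨g.rng.take m, g.src.take n, mem_cylinder.2 ?_⟩
  simp only [InfPath.length_take, true_and]
  exact ⟨hk, by ext i; exact h i⟩

/-- Every element lies in cylinder sets `Z(μ, ν)` with `ν` of any sufficiently large length. -/
theorem exists_cylinder_length (g : E.GraphGroupoid) :
    ∃ N, ∀ n, N ≤ n → ∃ μ ν : E.FinPath, ν.length = n ∧ g ∈ cylinder μ ν := by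
  obtain ⟨μ, ν, h⟩ := g.exists_cylinder
  refine ⟨ν.length, fun n hn => ⟨_, _, ?_, mem_cylinder_take h (n - ν.length)⟩⟩
  rw [InfPath.length_take]
  omega

theorem isOpen_cylinder (μ ν : E.FinPath) : IsOpen (cylinder μ ν) := by
  by_cases h : μ.source = ν.source
  · exact TopologicalSpace.isOpen_generateFrom_of_mem ⟨μ, ν, h, rfl⟩
  · convert isOpen_empty
    exact Set.eq_empty_of_forall_notMem fun g hg => h (source_eq_of_mem hg)

/-- An open set which contains `g` contains all cylinder sets around `g` given by sufficiently long
paths. -/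
theorem exists_cylinder_subset {U : Set E.GraphGroupoid} (hU : IsOpen U) {g : E.GraphGroupoid}
    (hg : g ∈ U) : ∃ N, ∀ μ ν : E.FinPath, N ≤ ν.length → g ∈ cylinder μ ν →
      cylinder μ ν ⊆ U := by
  induction hU with
  | basic U hU =>
    obtain ⟨μ, ν, -, rfl⟩ := hU
    exact ⟨ν.length, fun α β hl h f hf => mem_cylinder_of_le h hf hl hg⟩
  | univ => exact ⟨0, fun _ _ _ _ => Set.subset_univ _⟩
  | inter U V _ _ ihU ihV =>
    obtain ⟨N, hN⟩ := ihU hg.1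
    obtain ⟨M, hM⟩ := ihV hg.2
    exact ⟨max N M, fun μ ν hl h => Set.subset_inter (hN μ ν (by omega) h) (hM μ ν (by omega) h)⟩
  | sUnion S _ ih =>
    obtain ⟨U, hU, hgU⟩ := hg
    obtain ⟨N, hN⟩ := ih U hU hgU
    exact ⟨N, fun μ ν hl h => (hN μ ν hl h).trans (Set.subset_sUnion_of_mem hU)⟩

theorem isOpen_of_cylinder {U : Set E.GraphGroupoid}
    (h : ∀ g ∈ U, ∃ μ ν : E.FinPath, g ∈ cylinder μ ν ∧ cylinder μ ν ⊆ U) : IsOpen U := by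
  rw [isOpen_iff_forall_mem_open]
  intro g hg
  obtain ⟨μ, ν, h1, h2⟩ := h g hg
  exact ⟨_, h2, isOpen_cylinder μ ν, h1⟩

theorem isClopen_cylinder (μ ν : E.FinPath) : IsClopen (cylinder μ ν) := by
  refine ⟨⟨isOpen_of_cylinder fun g hg => ?_⟩, isOpen_cylinder μ ν⟩
  obtain ⟨N, hN⟩ := g.exists_cylinder_length
  obtain ⟨α, β, hl, h⟩ := hN (max N ν.length) (by omega)
  exact ⟨α, β, h, fun f hf hf' => hg (mem_cylinder_of_le hf h (by omega) hf')⟩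

theorem mem_cylinder_snoc {μ ν : E.FinPath} {e : E.Edge} (h : E.r e = μ.source)
    (h' : E.r e = ν.source) {g : E.GraphGroupoid} :
    g ∈ cylinder (μ.snoc e h) (ν.snoc e h') ↔
      g ∈ cylinder μ ν ∧ g.src.edge ν.length = e := by
  constructor
  · intro hg
    have hg' := mem_cylinder.1 hg
    simp only [FinPath.length_snoc] at hg'
    obtain ⟨h0, h1, h2, h3⟩ := hg'
    have key : ∀ {x : E.InfPath} {α : E.FinPath} {hα : E.r e = α.source},
        x.take (α.length + 1) = α.snoc e hα → x.take α.length = α ∧ x.edge α.length = e := by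
      intro x α hα hx
      rw [InfPath.take_succ] at hx
      have hE : (x.take α.length).edges ++ [x.edge α.length] = α.edges ++ [e] :=
        congrArg FinPath.edges hx
      have hR : (x.take α.length).range = α.range := (congrArg FinPath.range hx :)
      obtain ⟨h5, h6⟩ := List.append_inj' hE rfl
      exact ⟨FinPath.ext hR h5, by simpa using h6⟩
    obtain ⟨a1, a2⟩ := key h1
    obtain ⟨b1, b2⟩ := key h2
    refine ⟨mem_cylinder.2 ⟨by push_cast at h0; omega, a1, b1, ?_⟩, b2⟩
    ext i
    cases i with
    | zero => exact a2.trans b2.symm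
    | succ i =>
      have := congrFun (congrArg InfPath.edge h3) i
      change g.rng.edge (μ.length + 1 + i) = g.src.edge (ν.length + 1 + i) at this
      change g.rng.edge (μ.length + (i + 1)) = g.src.edge (ν.length + (i + 1))
      rwa [add_right_comm, add_right_comm ν.length, add_assoc, add_assoc] at this
  · rintro ⟨hg, rfl⟩
    have h1 := mem_cylinder.1 hg
    have h2 := mem_cylinder_take hg 1
    have h3 : g.rng.edge μ.length = g.src.edge ν.length :=
      congrFun (congrArg InfPath.edge h1.2.2.2) 0
    rw [InfPath.take_succ, InfPath.take_succ] at h2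
    rwa [FinPath.snoc_congr h1.2.1 h3, FinPath.snoc_congr h1.2.2.1 rfl] at h2

/-- Compactness of `Z(μ, ν)` in the form of an induction principle: a property of cylinder sets
holds for `Z(μ, ν)` if it passes from all `Z(α e, β e)` to `Z(α, β)`, and holds for some
cylinder set of the form `Z(μ γ, ν γ)` around every element of `Z(μ, ν)`. -/
theorem cylinder_induction (P : E.FinPath → E.FinPath → Prop)
    (hP : ∀ α β (h : α.source = β.source),
      (∀ (e : E.Edge) (he : E.r e = β.source), P (α.snoc e (he.trans h.symm)) (β.snoc e he)) →
      P α β)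
    (μ ν : E.FinPath) (h : μ.source = ν.source)
    (hloc : ∀ g ∈ cylinder μ ν, ∃ j : ℕ,
      P (g.rng.take (μ.length + j)) (g.src.take (ν.length + j))) : P μ ν := by
  by_contra hc
  -- a finite path `β` is bad if it prolongs `ν` and `P` fails for the matching pair
  let Q : E.FinPath → Prop := fun β => ∃ α : E.FinPath, α.source = β.source ∧ ¬ P α β ∧
    ∀ g, g ∈ cylinder α β → g ∈ cylinder μ ν ∧ ∃ j, α = g.rng.take (μ.length + j) ∧
      β = g.src.take (ν.length + j)
  have hQ : ∀ β, Q β → ∃ (e : E.Edge) (he : E.r e = β.source), Q (β.snoc e he) := by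
    rintro β ⟨α, hs, hn, hα⟩
    have := mt (hP α β hs) hn
    push Not at this
    obtain ⟨e, he, hn'⟩ := this
    refine ⟨e, he, α.snoc e (he.trans hs.symm), by simp, hn', fun g hg => ?_⟩
    have hg' := (mem_cylinder_snoc _ _).1 hg
    obtain ⟨h1, j, h2, h3⟩ := hα g hg'.1
    have hl : α.length = μ.length + j := by rw [h2, InfPath.length_take]
    have hl' : β.length = ν.length + j := by rw [h3, InfPath.length_take]
    have hm := mem_cylinder.1 hg
    simp only [FinPath.length_snoc] at hm
    refine ⟨h1, j + 1, ?_, ?_⟩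
    · rw [← add_assoc, ← hl]; exact hm.2.1.symm
    · rw [← add_assoc, ← hl']; exact hm.2.2.1.symm
  have hQν : Q ν := ⟨μ, h, hc, fun g hg => ⟨hg, 0, (mem_cylinder.1 hg).2.1.symm,
    (mem_cylinder.1 hg).2.2.1.symm⟩⟩
  obtain ⟨y, hy, hyQ⟩ := exists_infPath_of_extend Q hQ ν hQν
  obtain ⟨g, hg, hgd⟩ := exists_mem_cylinder h (y.drop ν.length) (by rw [y.range_drop, hy])
  have hgy : g.src = y :=
    InfPath.ext_take_drop ((mem_cylinder.1 hg).2.2.1.trans hy.symm) hgd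
  obtain ⟨j, hj⟩ := hloc g hg
  obtain ⟨α, hs, hn, hα⟩ := hyQ j
  obtain ⟨f, hf, hfd⟩ := exists_mem_cylinder hs (y.drop (ν.length + j)) (y.range_drop _)
  obtain ⟨h1, i, h2, h3⟩ := hα f hf
  have hfy : f.src = y := by
    have := (mem_cylinder.1 hf).2.2.1
    rw [InfPath.length_take] at this hfd
    exact InfPath.ext_take_drop this hfd
  have hfg : f = g := eq_of_mem_cylinder_of_src h1 hg (hfy.trans hgy.symm)
  have hij : ν.length + j = ν.length + i := by
    have := congrArg FinPath.length h3
    simpa using this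
  obtain rfl : j = i := by omega
  subst hfg
  rw [h2, ← hfy] at hn
  exact hn hj

end GraphGroupoid

namespace LeavittPathAlgebra

/-! ### Products of generators along paths -/

section PathProducts

variable {R : Type w} [CommRing R] {E : DirectedGraph.{u, v}}

theorem p_mul_pathProd (v : E.Vert) (l : List E.Edge) (hl : E.IsPathFrom v l) :
    p R E v * pathProd R v l = pathProd R v l := by
  cases l with
  | nil => exact (isLeavittFamily R E).idem v
  | cons e l =>
    obtain ⟨rfl, -⟩ := hl
    rw [pathProd, ← mul_assoc, (isLeavittFamily R E).range_edge]

theorem pathProd_mul_p (v : E.Vert) (l : List E.Edge) :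
    pathProd R v l * p R E (E.sourceFrom v l) = pathProd R v l := by
  induction l generalizing v with
  | nil => exact (isLeavittFamily R E).idem v
  | cons e l ih =>
    rw [pathProd, mul_assoc]
    exact congrArg _ (ih _)

theorem pathProd_concat (v : E.Vert) (l : List E.Edge) (e : E.Edge)
    (he : E.r e = E.sourceFrom v l) :
    pathProd R v (l ++ [e]) = pathProd R v l * se R E e := by
  induction l generalizing v with
  | nil =>
    change E.r e = v at he
    subst he
    change se R E e * p R E (E.s e) = p R E (E.r e) * se R E e
    rw [(isLeavittFamily R E).range_edge, (isLeavittFamily R E).edge_source]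
  | cons f l ih =>
    rw [List.cons_append, pathProd, pathProd, mul_assoc, ih _ he]

theorem p_mul_sPath (μ : E.FinPath) : p R E μ.range * sPath R μ = sPath R μ :=
  p_mul_pathProd _ _ μ.isPath

theorem p_mul_sPath_ne {v : E.Vert} {μ : E.FinPath} (h : v ≠ μ.range) :
    p R E v * sPath R μ = 0 := by
  rw [← p_mul_sPath, ← mul_assoc, (isLeavittFamily R E).orth _ _ h, zero_mul]

theorem sPath_mul_p (μ : E.FinPath) : sPath R μ * p R E μ.source = sPath R μ :=
  pathProd_mul_p _ _

theorem sPath_snoc (μ : E.FinPath) (e : E.Edge) (h : E.r e = μ.source) :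
    sPath R (μ.snoc e h) = sPath R μ * se R E e :=
  pathProd_concat _ _ _ h

theorem sPath_cons (e : E.Edge) (μ : E.FinPath) (h : E.s e = μ.range) :
    sPath R (FinPath.cons e μ h) = se R E e * sPath R μ := by
  change se R E e * pathProd R (E.s e) μ.edges = se R E e * pathProd R μ.range μ.edges
  rw [h]

variable [StarRing R]

variable (R) in
/-- The element `s_μ s_ν*` of the Leavitt path algebra. -/
def matUnit (μ ν : E.FinPath) : LeavittPathAlgebra R E := sPath R μ * star (sPath R ν)

theorem star_matUnit (μ ν : E.FinPath) : star (matUnit R μ ν) = matUnit R ν μ := by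
  rw [matUnit, star_mul, star_star, matUnit]

theorem matUnit_mul_p (μ ν : E.FinPath) : matUnit R μ ν * p R E ν.range = matUnit R μ ν := by
  rw [matUnit, mul_assoc, ← star_p (R := R) ν.range, ← star_mul, p_mul_sPath]

/-- The relation `s_μ s_ν* = ∑ s_{μe} s_{νe}*`, summed over the edges `e` with range
`s(μ) = s(ν)`. -/
theorem matUnit_eq_sum (hE : E.RowFinite) (hE' : E.NoSources) {μ ν : E.FinPath}
    (h : μ.source = ν.source) :
    matUnit R μ ν = ∑ e ∈ (hE ν.source).toFinset.attach,
      matUnit R (μ.snoc e.1 (((hE ν.source).mem_toFinset.1 e.2).trans h.symm))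
        (ν.snoc e.1 ((hE ν.source).mem_toFinset.1 e.2)) := by
  have hp := (isLeavittFamily R E).sum_eq ν.source (hE ν.source).toFinset
    (by simpa using hE' ν.source) (by simp)
  have h1 : matUnit R μ ν = sPath R μ * p R E ν.source * star (sPath R ν) := by
    rw [← h, sPath_mul_p, matUnit]
  rw [h1, hp, ← Finset.sum_attach, Finset.mul_sum, Finset.sum_mul]
  refine Finset.sum_congr rfl fun e _ => ?_
  rw [matUnit, sPath_snoc, sPath_snoc, star_mul, star_se]
  simp only [mul_assoc]

variable (R E) in
/-- The span of all `s_μ s_ν*` with `s(μ) = s(ν)`. -/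
def matUnitSpan : Submodule R (LeavittPathAlgebra R E) :=
  Submodule.span R {a | ∃ μ ν : E.FinPath, μ.source = ν.source ∧ a = matUnit R μ ν}

theorem matUnit_mem {μ ν : E.FinPath} (h : μ.source = ν.source) :
    matUnit R μ ν ∈ matUnitSpan R E :=
  Submodule.subset_span ⟨μ, ν, h, rfl⟩

theorem mul_mem_matUnitSpan_of {a : LeavittPathAlgebra R E}
    (h : ∀ μ ν : E.FinPath, μ.source = ν.source → a * matUnit R μ ν ∈ matUnitSpan R E)
    {b : LeavittPathAlgebra R E} (hb : b ∈ matUnitSpan R E) : a * b ∈ matUnitSpan R E := by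
  induction hb using Submodule.span_induction with
  | mem b hb =>
    obtain ⟨μ, ν, hs, rfl⟩ := hb
    exact h μ ν hs
  | zero => rw [mul_zero]; exact zero_mem _
  | add b c _ _ hb hc => rw [mul_add]; exact add_mem hb hc
  | smul t b _ hb => rw [mul_smul_comm]; exact Submodule.smul_mem _ _ hb

theorem p_mul_matUnit_mem (v : E.Vert) (μ ν : E.FinPath) (h : μ.source = ν.source) :
    p R E v * matUnit R μ ν ∈ matUnitSpan R E := by
  rw [matUnit, ← mul_assoc]
  by_cases hv : v = μ.range
  · rw [hv, p_mul_sPath]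
    exact matUnit_mem h
  · rw [p_mul_sPath_ne hv, zero_mul]
    exact zero_mem _

theorem se_mul_matUnit_mem (e : E.Edge) (μ ν : E.FinPath) (h : μ.source = ν.source) :
    se R E e * matUnit R μ ν ∈ matUnitSpan R E := by
  rw [matUnit, ← mul_assoc]
  by_cases hv : E.s e = μ.range
  · rw [← sPath_cons e μ hv]
    exact matUnit_mem ((FinPath.source_cons e μ hv).trans h)
  · rw [← (isLeavittFamily R E).edge_source, mul_assoc (se R E e), p_mul_sPath_ne hv, mul_zero,
      zero_mul]
    exact zero_mem _

theorem ghost_mul_matUnit_mem (e : E.Edge) (μ ν : E.FinPath) (h : μ.source = ν.source) :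
    ghost R E e * matUnit R μ ν ∈ matUnitSpan R E := by
  obtain ⟨v, l, hl⟩ := μ
  cases l with
  | nil =>
    change v = ν.source at h
    have h0 : ghost R E e * matUnit R ⟨v, [], hl⟩ ν =
        (ghost R E e * p R E v) * star (sPath R ν) := by
      rw [matUnit, mul_assoc]; rfl
    rw [h0]
    by_cases hv : E.r e = v
    · subst hv
      rw [(isLeavittFamily R E).ghost_range, ← star_se, ← star_mul, ← sPath_snoc ν e h]
      have h1 : matUnit R (FinPath.nil (E.s e)) (ν.snoc e h) = star (sPath R (ν.snoc e h)) := by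
        have h2 := sPath_mul_p (R := R) (ν.snoc e h)
        rw [FinPath.source_snoc] at h2
        conv_rhs => rw [← h2, star_mul]
        rfl
      rw [← h1]
      exact matUnit_mem (FinPath.source_snoc ν e h).symm
    · rw [← (isLeavittFamily R E).ghost_range, mul_assoc (ghost R E e),
        (isLeavittFamily R E).orth _ _ hv, mul_zero, zero_mul]
      exact zero_mem _
  | cons f l =>
    have h0 : ghost R E e * matUnit R ⟨v, f :: l, hl⟩ ν =
        (ghost R E e * se R E f) * (pathProd R (E.s f) l * star (sPath R ν)) := by
      rw [matUnit, sPath, pathProd]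
      simp only [mul_assoc]
    rw [h0]
    by_cases hv : e = f
    · subst hv
      rw [(isLeavittFamily R E).ghost_edge_self, ← mul_assoc, p_mul_pathProd _ _ hl.2]
      exact matUnit_mem (μ := ⟨E.s e, l, hl.2⟩) h
    · rw [(isLeavittFamily R E).ghost_edge_ne _ _ hv, zero_mul]
      exact zero_mem _

theorem mul_mem_matUnitSpan (a : Expr R E) :
    ∀ b ∈ matUnitSpan R E, mk a * b ∈ matUnitSpan R E := by
  induction a with
  | vert v => exact fun b hb => mul_mem_matUnitSpan_of (p_mul_matUnit_mem v) hb
  | edge e => exact fun b hb => mul_mem_matUnitSpan_of (se_mul_matUnit_mem e) hb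
  | ghost e => exact fun b hb => mul_mem_matUnitSpan_of (ghost_mul_matUnit_mem e) hb
  | zero =>
    intro b _
    change (0 : LeavittPathAlgebra R E) * b ∈ _
    rw [zero_mul]
    exact zero_mem _
  | add a c iha ihc =>
    intro b hb
    change (mk a + mk c) * b ∈ _
    rw [add_mul]
    exact add_mem (iha b hb) (ihc b hb)
  | mul a c iha ihc =>
    intro b hb
    change (mk a * mk c) * b ∈ _
    rw [mul_assoc]
    exact iha _ (ihc b hb)
  | smul t a ih =>
    intro b hb
    change (t • mk a) * b ∈ _
    rw [smul_mul_assoc]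
    exact Submodule.smul_mem _ _ (ih b hb)

/-- The elements `s_μ s_ν*` with `s(μ) = s(ν)` span the Leavitt path algebra. -/
theorem matUnitSpan_eq_top : matUnitSpan R E = ⊤ := by
  refine (Submodule.eq_top_iff'.2 fun a => ?_)
  obtain ⟨a, rfl⟩ := Quot.exists_rep a
  change mk a ∈ _
  have hv : ∀ v, p R E v ∈ matUnitSpan R E := fun v => by
    have h : matUnit R (FinPath.nil v) (FinPath.nil v) = p R E v :=
      (isLeavittFamily R E).idem v
    rw [← h]
    exact matUnit_mem rfl
  induction a with
  | vert v => exact hv v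
  | edge e =>
    have := mul_mem_matUnitSpan (R := R) (.edge e) _ (hv (E.s e))
    rwa [show mk (.edge e) * p R E (E.s e) = mk (.edge e) from
      (isLeavittFamily R E).edge_source e] at this
  | ghost e =>
    have := mul_mem_matUnitSpan (R := R) (.ghost e) _ (hv (E.r e))
    rwa [show mk (.ghost e) * p R E (E.r e) = mk (.ghost e) from
      (isLeavittFamily R E).ghost_range e] at this
  | zero => exact zero_mem (matUnitSpan R E)
  | add a b iha ihb => exact add_mem iha ihb
  | mul a b _ ihb => exact mul_mem_matUnitSpan a _ ihb
  | smul t a ih => exact Submodule.smul_mem (matUnitSpan R E) t ih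

theorem induction_matUnit {P : LeavittPathAlgebra R E → Prop} (h0 : P 0)
    (hadd : ∀ a b, P a → P b → P (a + b)) (hsmul : ∀ (t : R) a, P a → P (t • a))
    (h : ∀ μ ν : E.FinPath, μ.source = ν.source → P (matUnit R μ ν))
    (a : LeavittPathAlgebra R E) : P a := by
  have ha : a ∈ matUnitSpan R E := matUnitSpan_eq_top (R := R) (E := E) ▸ Submodule.mem_top
  induction ha using Submodule.span_induction with
  | mem b hb =>
    obtain ⟨μ, ν, hs, rfl⟩ := hb
    exact h μ ν hs
  | zero => exact h0
  | add b c _ _ hb hc => exact hadd b c hb hc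
  | smul t b _ hb => exact hsmul t b hb

end PathProducts

/-! ### The path representation -/

section Representation

open Classical in
variable (R : Type w) [CommRing R] (E : DirectedGraph.{u, v}) in
/-- The operator `δ_(x, k) ↦ δ_(x, k)` if `r(x) = v`, and `δ_(x, k) ↦ 0` otherwise. -/
noncomputable def opVert (w : E.Vert) : Module.End R (E.InfPath × ℤ →₀ R) :=
  Finsupp.linearCombination R fun q => if q.1.range = w then Finsupp.single q 1 else 0

open Classical in
variable (R : Type w) [CommRing R] (E : DirectedGraph.{u, v}) in
/-- The operator `δ_(z, k) ↦ δ_(e z, k + 1)` if `r(z) = s(e)`, and `δ_(z, k) ↦ 0` otherwise. -/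
noncomputable def opEdge (e : E.Edge) : Module.End R (E.InfPath × ℤ →₀ R) :=
  Finsupp.linearCombination R fun q =>
    if h : q.1.range = E.s e then Finsupp.single (q.1.cons e h, q.2 + 1) 1 else 0

open Classical in
variable (R : Type w) [CommRing R] (E : DirectedGraph.{u, v}) in
/-- The operator `δ_(e z, k) ↦ δ_(z, k - 1)`, which kills `δ_(x, k)` if `x` does not start
with `e`. -/
noncomputable def opGhost (e : E.Edge) : Module.End R (E.InfPath × ℤ →₀ R) :=
  Finsupp.linearCombination R fun q =>
    if q.1.edge 0 = e then Finsupp.single (q.1.drop 1, q.2 - 1) 1 else 0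

variable {R : Type w} [CommRing R] {E : DirectedGraph.{u, v}}

open Classical in
theorem opVert_single (w : E.Vert) (x : E.InfPath) (k : ℤ) :
    opVert R E w (Finsupp.single (x, k) 1) =
      if x.range = w then Finsupp.single (x, k) 1 else 0 := by
  simp [opVert]

theorem opEdge_single {e : E.Edge} {z : E.InfPath} (h : z.range = E.s e) (k : ℤ) :
    opEdge R E e (Finsupp.single (z, k) 1) = Finsupp.single (z.cons e h, k + 1) 1 := by
  simp [opEdge, h]

theorem opEdge_single_ne {e : E.Edge} {z : E.InfPath} (h : z.range ≠ E.s e) (k : ℤ) :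
    opEdge R E e (Finsupp.single (z, k) 1) = 0 := by
  simp [opEdge, h]

open Classical in
theorem opGhost_single (e : E.Edge) (x : E.InfPath) (k : ℤ) :
    opGhost R E e (Finsupp.single (x, k) 1) =
      if x.edge 0 = e then Finsupp.single (x.drop 1, k - 1) 1 else 0 := by
  simp [opGhost]

theorem isLeavittFamily_op : E.IsLeavittFamily (opVert R E) (opEdge R E) (opGhost R E) := by
  classical
  have hext : ∀ {S T : Module.End R (E.InfPath × ℤ →₀ R)},
      (∀ x k, S (Finsupp.single (x, k) 1) = T (Finsupp.single (x, k) 1)) → S = T := by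
    intro S T h
    refine Finsupp.lhom_ext' fun q => LinearMap.ext_ring ?_
    exact h q.1 q.2
  constructor
  · intro w
    refine hext fun x k => ?_
    simp only [Module.End.mul_apply, opVert_single]
    split_ifs with h <;> simp [opVert_single, h]
  · intro w w' hne
    refine hext fun x k => ?_
    simp only [Module.End.mul_apply, opVert_single]
    split_ifs with h
    · simp [opVert_single, h, hne.symm]
    · simp
  · intro e
    refine hext fun x k => ?_
    by_cases h : x.range = E.s e
    · simp only [Module.End.mul_apply, opEdge_single h, opVert_single]
      exact if_pos rfl
    · simp [Module.End.mul_apply, opEdge_single_ne h]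
  · intro e
    refine hext fun x k => ?_
    by_cases h : x.range = E.s e
    · simp [Module.End.mul_apply, opVert_single, h]
    · simp [Module.End.mul_apply, opVert_single, h, opEdge_single_ne h]
  · intro e
    refine hext fun x k => ?_
    simp only [Module.End.mul_apply, opGhost_single]
    split_ifs with h
    · rw [opVert_single, if_pos (by rw [InfPath.range_drop_one, h])]
    · simp
  · intro e
    refine hext fun x k => ?_
    simp only [Module.End.mul_apply, opVert_single, opGhost_single]
    by_cases h : x.edge 0 = e
    · simp [h, InfPath.range, opGhost_single]
    · split_ifs with h' <;> simp [opGhost_single, h]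
  · intro e
    refine hext fun x k => ?_
    by_cases h : x.range = E.s e
    · rw [Module.End.mul_apply, opEdge_single h, opGhost_single, if_pos (by rfl), opVert_single,
        if_pos h, InfPath.drop_one_cons, add_sub_cancel_right]
    · simp [Module.End.mul_apply, opEdge_single_ne h, opVert_single, h]
  · intro e f hne
    refine hext fun x k => ?_
    by_cases h : x.range = E.s f
    · rw [Module.End.mul_apply, opEdge_single h, opGhost_single, if_neg (fun h => hne h.symm)]
      rfl
    · simp [Module.End.mul_apply, opEdge_single_ne h]
  · intro w X _ hX
    refine hext fun x k => ?_
    rw [LinearMap.sum_apply]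
    have key : ∀ e, (opEdge R E e * opGhost R E e) (Finsupp.single (x, k) 1) =
        if x.edge 0 = e then Finsupp.single (x, k) 1 else 0 := by
      intro e
      rw [Module.End.mul_apply, opGhost_single]
      split_ifs with h
      · have h1 : (x.drop 1).range = E.s e := by rw [InfPath.range_drop_one, h]
        rw [opEdge_single h1, InfPath.cons_drop_one h1 h, sub_add_cancel]
      · exact map_zero _
    simp only [key, Finset.sum_ite_eq, opVert_single, hX]
    rfl

variable (R E) in
/-- The representation of the Leavitt path algebra on the free module with basis `E^∞ × ℤ`; the
second coordinate records the grading, which makes it faithful. -/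
noncomputable def pathRep :
    LeavittPathAlgebra R E →ₙₐ[R] Module.End R (E.InfPath × ℤ →₀ R) :=
  (existsUnique_hom (isLeavittFamily_op (R := R) (E := E))).choose

theorem pathRep_spec : (∀ w, pathRep R E (p R E w) = opVert R E w) ∧
    (∀ e, pathRep R E (se R E e) = opEdge R E e) ∧
      ∀ e, pathRep R E (ghost R E e) = opGhost R E e :=
  (existsUnique_hom (isLeavittFamily_op (R := R) (E := E))).choose_spec.1

theorem pathRep_sPath (μ : E.FinPath) (x : E.InfPath) (k : ℤ) (h : x.take μ.length = μ) :
    pathRep R E (sPath R μ) (Finsupp.single (x.drop μ.length, k) 1) =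
      Finsupp.single (x, k + μ.length) 1 := by
  classical
  obtain ⟨v, l, hl⟩ := μ
  induction l generalizing v x k with
  | nil =>
    have h1 : x.range = v := congrArg FinPath.range h
    have h2 : x.drop 0 = x := by ext i; exact congrArg x.edge (zero_add i)
    change pathRep R E (p R E v) (Finsupp.single (x.drop 0, k) 1) = Finsupp.single (x, k + 0) 1
    rw [h2, pathRep_spec.1, opVert_single, if_pos h1, add_zero]
  | cons e l ih =>
    have h0 : (List.range (l.length + 1)).map x.edge = e :: l := congrArg FinPath.edges h
    rw [List.range_succ_eq_map, List.map_cons, List.map_map] at h0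
    obtain ⟨h1, h2⟩ := List.cons.inj h0
    have h3 : (x.drop 1).range = E.s e := by rw [InfPath.range_drop_one, h1]
    have h4 : (x.drop 1).take l.length = ⟨E.s e, l, hl.2⟩ :=
      FinPath.ext h3
        ((List.map_congr_left fun i _ => congrArg x.edge (add_comm 1 i)).trans h2)
    have h5 := ih (x.drop 1) k (E.s e) hl.2 h4
    change pathRep R E (pathProd R (E.s e) l)
      (Finsupp.single ((x.drop 1).drop l.length, k) 1) =
        Finsupp.single (x.drop 1, k + l.length) 1 at h5
    change pathRep R E (se R E e * pathProd R (E.s e) l)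
      (Finsupp.single (x.drop (l.length + 1), k) 1) = Finsupp.single (x, k + (l.length + 1 : ℕ)) 1
    rw [map_mul, Module.End.mul_apply, add_comm l.length 1, ← InfPath.drop_drop, h5,
      pathRep_spec.2.1, opEdge_single h3, InfPath.cons_drop_one h3 h1]
    congr 2
    push_cast
    ring

open Classical in
theorem pathRep_star_sPath [StarRing R] (ν : E.FinPath) (y : E.InfPath) (k : ℤ) :
    pathRep R E (star (sPath R ν)) (Finsupp.single (y, k) 1) =
      if y.take ν.length = ν then Finsupp.single (y.drop ν.length, k - ν.length) 1 else 0 := by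
  obtain ⟨v, l, hl⟩ := ν
  induction l generalizing v y k with
  | nil =>
    have h1 : y.take 0 = ⟨v, [], hl⟩ ↔ y.range = v :=
      ⟨fun h => congrArg FinPath.range h, fun h => FinPath.ext h rfl⟩
    have h2 : y.drop 0 = y := by ext i; exact congrArg y.edge (zero_add i)
    change pathRep R E (p R E v) (Finsupp.single (y, k) 1) =
      if y.take 0 = ⟨v, [], hl⟩ then Finsupp.single (y.drop 0, k - 0) 1 else 0
    rw [h2, pathRep_spec.1, opVert_single, sub_zero]
    simp only [h1]
  | cons e l ih =>
    have h1 : y.take (l.length + 1) = ⟨v, e :: l, hl⟩ ↔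
        y.edge 0 = e ∧ (y.drop 1).take l.length = ⟨E.s e, l, hl.2⟩ := by
      have h0 : ((List.range l.length).map (y.edge ∘ Nat.succ)) =
          (List.range l.length).map (y.drop 1).edge :=
        List.map_congr_left fun i _ => congrArg y.edge (add_comm i 1)
      constructor
      · intro h
        have h2 : (List.range (l.length + 1)).map y.edge = e :: l := congrArg FinPath.edges h
        rw [List.range_succ_eq_map, List.map_cons, List.map_map] at h2
        obtain ⟨h3, h4⟩ := List.cons.inj h2
        exact ⟨h3, FinPath.ext ((InfPath.range_drop_one y).trans (congrArg E.s h3))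
          (h0.symm.trans h4)⟩
      · rintro ⟨h3, h4⟩
        refine FinPath.ext ?_ ?_
        · exact (congrArg E.r h3).trans hl.1
        · change (List.range (l.length + 1)).map y.edge = e :: l
          rw [List.range_succ_eq_map, List.map_cons, List.map_map, h0, h3]
          exact congrArg (e :: ·) (congrArg FinPath.edges h4)
    change pathRep R E (star (se R E e * pathProd R (E.s e) l)) (Finsupp.single (y, k) 1) =
      if y.take (l.length + 1) = ⟨v, e :: l, hl⟩ then
        Finsupp.single (y.drop (l.length + 1), k - (l.length + 1 : ℕ)) 1 else 0
    rw [star_mul, map_mul, Module.End.mul_apply, star_se, pathRep_spec.2.2, opGhost_single]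
    simp only [h1]
    by_cases he : y.edge 0 = e
    · rw [if_pos he]
      refine (ih (y.drop 1) (k - 1) (E.s e) hl.2).trans ?_
      simp only [he, true_and]
      change (if (y.drop 1).take l.length = ⟨E.s e, l, hl.2⟩ then
        Finsupp.single ((y.drop 1).drop l.length, k - 1 - l.length) 1 else 0) = _
      rw [InfPath.drop_drop, add_comm 1]
      congr 3
      push_cast
      ring
    · simp [he]

variable [StarRing R]

open Classical in
/-- The matrix coefficients of `s_μ s_ν*` in the path representation. -/
theorem pathRep_matUnit {μ ν : E.FinPath} (h : μ.source = ν.source) (x y : E.InfPath)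
    (k l : ℤ) : pathRep R E (matUnit R μ ν) (Finsupp.single (y, l) 1) (x, k) =
      if k - l = (μ.length : ℤ) - ν.length ∧ x.take μ.length = μ ∧ y.take ν.length = ν ∧
        x.drop μ.length = y.drop ν.length then 1 else 0 := by
  rw [matUnit, map_mul, Module.End.mul_apply, pathRep_star_sPath]
  by_cases hy : y.take ν.length = ν
  · obtain ⟨x', hx, hx'⟩ := exists_concat μ (y.drop ν.length) (by rw [y.range_drop, hy, h])
    rw [if_pos hy, ← hx', pathRep_sPath μ x' _ hx, Finsupp.single_apply]
    refine if_congr ?_ rfl rfl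
    rw [Prod.mk.injEq]
    constructor
    · rintro ⟨rfl, rfl⟩
      exact ⟨by ring, hx, hy, rfl⟩
    · rintro ⟨h1, h2, -, h3⟩
      exact ⟨InfPath.ext_take_drop (hx.trans h2.symm) h3.symm, by omega⟩
  · rw [if_neg hy, map_zero, if_neg (fun h => hy h.2.2.1)]
    rfl

/-- The path representation commutes with the shift of the second coordinate. -/
theorem pathRep_shift (a : LeavittPathAlgebra R E) (x y : E.InfPath) (k l : ℤ) :
    pathRep R E a (Finsupp.single (y, l) 1) (x, k) =
      pathRep R E a (Finsupp.single (y, 0) 1) (x, k - l) := by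
  classical
  induction a using induction_matUnit with
  | h0 => simp
  | hadd a b ha hb => simp [ha, hb]
  | hsmul t a ha => simp [ha]
  | h μ ν h => simp only [pathRep_matUnit h, sub_zero]

theorem shiftEquiv_of_pathRep_ne_zero (a : LeavittPathAlgebra R E) (x y : E.InfPath) (k : ℤ)
    (h : pathRep R E a (Finsupp.single (y, 0) 1) (x, k) ≠ 0) : ShiftEquiv x k y := by
  classical
  by_contra hc
  refine h ?_
  clear h
  induction a using induction_matUnit with
  | h0 => simp
  | hadd a b ha hb =>
    simp only [map_add, LinearMap.add_apply, Finsupp.add_apply]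
    rw [ha, hb, add_zero]
  | hsmul t a ha =>
    simp only [map_smul, LinearMap.smul_apply, Finsupp.smul_apply]
    rw [ha, smul_zero]
  | h μ ν hs =>
    rw [pathRep_matUnit hs, if_neg]
    rintro ⟨h1, -, -, h2⟩
    exact hc ⟨μ.length, ν.length, by omega, fun i => congrFun (congrArg InfPath.edge h2) i⟩

end Representation

/-! ### Elements of the Leavitt path algebra as functions on the groupoid -/

section Functions

variable {R : Type w} [CommRing R] {E : DirectedGraph.{u, v}}

/-- The element `a` as a function on the graph groupoid: its value at `(x, k, y)` is the
coefficient of `δ_(x, k)` in `a δ_(y, 0)`. -/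
noncomputable def ev : LeavittPathAlgebra R E →ₗ[R] (E.GraphGroupoid → R) where
  toFun a g := pathRep R E a (Finsupp.single (g.src, 0) 1) (g.rng, g.lag)
  map_add' a b := by ext g; simp
  map_smul' t a := by ext g; simp

open GraphGroupoid

theorem ev_add (a b : LeavittPathAlgebra R E) (g : E.GraphGroupoid) :
    ev (a + b) g = ev a g + ev b g := by simp

theorem ev_smul (t : R) (a : LeavittPathAlgebra R E) (g : E.GraphGroupoid) :
    ev (t • a) g = t * ev a g := by simp

theorem ev_zero (g : E.GraphGroupoid) : ev (0 : LeavittPathAlgebra R E) g = 0 := by simp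

theorem finite_setOf_src (a : LeavittPathAlgebra R E) (y : E.InfPath) :
    {g : E.GraphGroupoid | g.src = y ∧ ev a g ≠ 0}.Finite := by
  let f := pathRep R E a (Finsupp.single (y, 0) 1)
  refine Set.Finite.of_finite_image (f := fun g : E.GraphGroupoid => (g.rng, g.lag))
    (f.support.finite_toSet.subset ?_) ?_
  · rintro _ ⟨g, ⟨rfl, hg⟩, rfl⟩
    exact Finsupp.mem_support_iff.2 hg
  · rintro g ⟨hg, -⟩ h ⟨hh, -⟩ he
    exact GraphGroupoid.ext (congrArg Prod.fst he) (congrArg Prod.snd he) (hg.trans hh.symm)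

variable [StarRing R]

open Classical in
/-- The element `s_μ s_ν*` is the indicator function of `Z(μ, ν)`. -/
theorem ev_matUnit {μ ν : E.FinPath} (h : μ.source = ν.source) (g : E.GraphGroupoid) :
    ev (matUnit R μ ν) g = if g ∈ cylinder μ ν then 1 else 0 := by
  change pathRep R E _ _ _ = _
  rw [pathRep_matUnit h, sub_zero]
  exact if_congr mem_cylinder.symm rfl rfl

theorem ev_matUnit_of_mem {μ ν : E.FinPath} {g : E.GraphGroupoid} (h : g ∈ cylinder μ ν) :
    ev (matUnit R μ ν) g = 1 := by
  rw [ev_matUnit (source_eq_of_mem h), if_pos h]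

theorem ev_star (a : LeavittPathAlgebra R E) (g : E.GraphGroupoid) :
    ev (star a) g = star (ev a g.inv) := by
  classical
  induction a using induction_matUnit with
  | h0 => simp
  | hadd a b ha hb => rw [star_add, ev_add, ev_add, ha, hb, star_add]
  | hsmul t a ha => rw [star_smul, ev_smul, ev_smul, ha, star_mul, mul_comm]
  | h μ ν h =>
    rw [star_matUnit, ev_matUnit h, ev_matUnit h.symm]
    simp only [inv_mem_cylinder]
    split_ifs <;> simp

/-- The product is convolution: the value of `a b` at `g` is the sum of all `a(g h⁻¹) b(h)`. -/
theorem ev_mul (a b : LeavittPathAlgebra R E) (g : E.GraphGroupoid) :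
    ev (a * b) g = ∑ᶠ h : {h : E.GraphGroupoid // g.src = h.src},
      ev a (g.comp h.1.inv h.2) * ev b h.1 := by
  let f := pathRep R E b (Finsupp.single (g.src, 0) 1)
  let A : E.InfPath × ℤ → R := fun q =>
    pathRep R E a (Finsupp.single (q.1, 0) 1) (g.rng, g.lag - q.2) * f q
  have h1 : ev (a * b) g = ∑ q ∈ f.support, A q := by
    change pathRep R E (a * b) _ _ = _
    rw [map_mul, Module.End.mul_apply]
    change pathRep R E a f _ = _
    conv_lhs => rw [← Finsupp.sum_single f, Finsupp.sum, map_sum, Finsupp.finsetSum_apply]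
    refine Finset.sum_congr rfl fun q _ => ?_
    have : Finsupp.single q (f q) = f q • Finsupp.single q (1 : R) := by simp
    rw [this, map_smul, Finsupp.smul_apply, smul_eq_mul, mul_comm]
    exact congrArg (· * f q) (pathRep_shift a g.rng q.1 g.lag q.2)
  let ι : {h : E.GraphGroupoid // g.src = h.src} → E.InfPath × ℤ := fun h => (h.1.rng, h.1.lag)
  have hι : Function.Injective ι := by
    rintro ⟨h, hh⟩ ⟨k, hk⟩ he
    exact Subtype.ext (GraphGroupoid.ext (congrArg Prod.fst he) (congrArg Prod.snd he)
      (hh.symm.trans hk))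
  have h2 : ∀ h, ev a (g.comp h.1.inv h.2) * ev b h.1 = A (ι h) := by
    rintro ⟨h, hh⟩
    change pathRep R E a (Finsupp.single (h.rng, 0) 1) (g.rng, g.lag + -h.lag) *
      pathRep R E b (Finsupp.single (h.src, 0) 1) (h.rng, h.lag) = _
    rw [← hh, ← sub_eq_add_neg]
  rw [finsum_congr h2, ← finsum_mem_range hι, h1]
  refine (finsum_mem_eq_sum_of_inter_support_eq _ ?_).symm
  ext q
  simp only [Set.mem_inter_iff, Function.mem_support, Finset.mem_coe, Finsupp.mem_support_iff]
  refine and_congr_left fun hA => ⟨fun _ => right_ne_zero_of_mul hA, fun hq => ?_⟩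
  exact ⟨⟨⟨q.1, q.2, g.src, shiftEquiv_of_pathRep_ne_zero b _ _ _ hq⟩, rfl⟩, rfl⟩

theorem finite_setOf_rng (a : LeavittPathAlgebra R E) (x : E.InfPath) :
    {g : E.GraphGroupoid | g.rng = x ∧ ev a g ≠ 0}.Finite := by
  refine ((finite_setOf_src (star a) x).image inv).subset ?_
  rintro g ⟨hg, ha⟩
  refine ⟨g.inv, ⟨hg, ?_⟩, inv_of_inv g⟩
  rw [ev_star, inv_of_inv]
  simpa using ha

theorem exists_of_ev_mul_ne_zero {a b : LeavittPathAlgebra R E} {g : E.GraphGroupoid}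
    (h : ev (a * b) g ≠ 0) : ∃ (g₁ g₂ : E.GraphGroupoid) (hc : g₁.src = g₂.rng),
      g₁.comp g₂ hc = g ∧ ev a g₁ ≠ 0 ∧ ev b g₂ ≠ 0 := by
  rw [ev_mul] at h
  obtain ⟨⟨k, hk⟩, h'⟩ : ∃ k : {k : E.GraphGroupoid // g.src = k.src},
      ev a (g.comp k.1.inv k.2) * ev b k.1 ≠ 0 := by
    by_contra! hc
    exact h ((finsum_congr hc).trans finsum_zero)
  refine ⟨_, k, rfl, ?_, left_ne_zero_of_mul h', right_ne_zero_of_mul h'⟩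
  exact GraphGroupoid.ext rfl (by simp [comp, inv]) hk.symm

/-- If the supports of `a` and `b` allow a single factorization of a groupoid element, then the
convolution there is a single product. -/
theorem ev_mul_comp {a b : LeavittPathAlgebra R E} (g₁ g₂ : E.GraphGroupoid)
    (hc : g₁.src = g₂.rng)
    (h : ∀ (h₁ h₂ : E.GraphGroupoid) (hc' : h₁.src = h₂.rng), h₁.comp h₂ hc' = g₁.comp g₂ hc →
      ev a h₁ ≠ 0 → ev b h₂ ≠ 0 → h₂ = g₂) :
    ev (a * b) (g₁.comp g₂ hc) = ev a g₁ * ev b g₂ := by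
  rw [ev_mul, finsum_eq_single _ ⟨g₂, rfl⟩]
  · refine congrArg (ev a · * ev b g₂) (GraphGroupoid.ext rfl ?_ hc.symm)
    exact add_neg_cancel_right g₁.lag g₂.lag
  · rintro ⟨k, hk⟩ hne
    by_contra h'
    refine hne (Subtype.ext (h _ k rfl ?_ (left_ne_zero_of_mul h') (right_ne_zero_of_mul h')))
    exact GraphGroupoid.ext rfl (by simp [comp, inv]) hk.symm

/-- Every element is a locally constant function. -/
theorem exists_locallyConstant (a : LeavittPathAlgebra R E) : ∃ N, ∀ α β : E.FinPath,
    N ≤ β.length → ∀ f ∈ cylinder α β, ∀ g ∈ cylinder α β, ev a f = ev a g := by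
  classical
  induction a using induction_matUnit with
  | h0 => exact ⟨0, by simp⟩
  | hadd a b ha hb =>
    obtain ⟨N, hN⟩ := ha
    obtain ⟨M, hM⟩ := hb
    refine ⟨max N M, fun α β hl f hf g hg => ?_⟩
    rw [ev_add, ev_add, hN α β (by omega) f hf g hg, hM α β (by omega) f hf g hg]
  | hsmul t a ha =>
    obtain ⟨N, hN⟩ := ha
    exact ⟨N, fun α β hl f hf g hg => by rw [ev_smul, ev_smul, hN α β hl f hf g hg]⟩
  | h μ ν h =>
    refine ⟨ν.length, fun α β hl f hf g hg => ?_⟩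
    rw [ev_matUnit h, ev_matUnit h]
    exact if_congr ⟨mem_cylinder_of_le hf hg hl, mem_cylinder_of_le hg hf hl⟩ rfl rfl

/-- The support of an element is covered by cylinder sets `Z(α, β)` with `β` of any given
sufficiently large length. -/
theorem exists_cylinder_of_support (a : LeavittPathAlgebra R E) : ∃ N, ∀ n, N ≤ n →
    ∀ g, ev a g ≠ 0 → ∃ α β : E.FinPath, β.length = n ∧ g ∈ cylinder α β := by
  classical
  induction a using induction_matUnit with
  | h0 => exact ⟨0, by simp⟩
  | hadd a b ha hb =>
    obtain ⟨N, hN⟩ := ha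
    obtain ⟨M, hM⟩ := hb
    refine ⟨max N M, fun n hn g hg => ?_⟩
    by_cases h : ev a g = 0
    · exact hM n (by omega) g fun h' => hg (by rw [ev_add, h, h', add_zero])
    · exact hN n (by omega) g h
  | hsmul t a ha =>
    obtain ⟨N, hN⟩ := ha
    exact ⟨N, fun n hn g hg => hN n hn g fun h => hg (by rw [ev_smul, h, mul_zero])⟩
  | h μ ν h =>
    refine ⟨ν.length, fun n hn g hg => ?_⟩
    rw [ev_matUnit h] at hg
    have hm : g ∈ cylinder μ ν := by
      by_contra hc
      exact hg (if_neg hc)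
    exact ⟨_, _, by rw [InfPath.length_take]; omega, mem_cylinder_take hm (n - ν.length)⟩

theorem isOpen_support (a : LeavittPathAlgebra R E) :
    IsOpen {g : E.GraphGroupoid | ev a g ≠ 0} := by
  obtain ⟨N, hN⟩ := exists_locallyConstant a
  refine isOpen_of_cylinder fun g hg => ?_
  obtain ⟨M, hM⟩ := g.exists_cylinder_length
  obtain ⟨μ, ν, hl, h⟩ := hM (max N M) (by omega)
  refine ⟨μ, ν, h, fun f hf => ?_⟩
  change ev a f ≠ 0
  rwa [hN μ ν (by omega) f hf g h]

variable (R E) in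
/-- The span of all `s_μ s_ν*` with `s(μ) = s(ν)` and `|ν| = n`. -/
def levelSpan (n : ℕ) : Submodule R (LeavittPathAlgebra R E) :=
  Submodule.span R ((fun q : E.FinPath × E.FinPath => matUnit R q.1 q.2) ''
    {q | q.1.source = q.2.source ∧ q.2.length = n})

theorem matUnit_mem_levelSpan (hE : E.RowFinite) (hE' : E.NoSources) (k : ℕ)
    {μ ν : E.FinPath} (h : μ.source = ν.source) :
    matUnit R μ ν ∈ levelSpan R E (ν.length + k) := by
  induction k generalizing μ ν with
  | zero => exact Submodule.subset_span ⟨(μ, ν), ⟨h, rfl⟩, rfl⟩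
  | succ k ih =>
    rw [matUnit_eq_sum hE hE' h]
    refine Submodule.sum_mem _ fun e _ => ?_
    have h1 := (hE ν.source).mem_toFinset.1 e.2
    have := ih (μ := μ.snoc e.1 (h1.trans h.symm)) (ν := ν.snoc e.1 h1) (by simp)
    rwa [FinPath.length_snoc, add_right_comm, add_assoc] at this

theorem exists_mem_levelSpan (hE : E.RowFinite) (hE' : E.NoSources)
    (a : LeavittPathAlgebra R E) : ∃ N, ∀ n, N ≤ n → a ∈ levelSpan R E n := by
  induction a using induction_matUnit with
  | h0 => exact ⟨0, fun n _ => zero_mem _⟩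
  | hadd a b ha hb =>
    obtain ⟨N, hN⟩ := ha
    obtain ⟨M, hM⟩ := hb
    exact ⟨max N M, fun n hn => add_mem (hN n (by omega)) (hM n (by omega))⟩
  | hsmul t a ha =>
    obtain ⟨N, hN⟩ := ha
    exact ⟨N, fun n hn => Submodule.smul_mem _ _ (hN n hn)⟩
  | h μ ν h =>
    refine ⟨ν.length, fun n hn => ?_⟩
    obtain ⟨k, rfl⟩ := Nat.exists_eq_add_of_le hn
    exact matUnit_mem_levelSpan hE hE' k h

/-- Every element is a combination of elements `s_μ s_ν*` with all `ν` of one length, and its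
value on `Z(μ, ν)` is the coefficient of `s_μ s_ν*`. -/
theorem exists_normalForm (hE : E.RowFinite) (hE' : E.NoSources)
    (a : LeavittPathAlgebra R E) : ∃ c : E.FinPath × E.FinPath →₀ R,
      a = c.sum (fun q t => t • matUnit R q.1 q.2) ∧
      ∀ q ∈ c.support, q.1.source = q.2.source ∧ ∀ g ∈ cylinder q.1 q.2, ev a g = c q := by
  classical
  obtain ⟨N, hN⟩ := exists_mem_levelSpan hE hE' a
  obtain ⟨c, hc, hca⟩ := (Finsupp.mem_span_image_iff_linearCombination R).1 (hN N le_rfl)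
  rw [Finsupp.linearCombination_apply] at hca
  have hc' : ∀ q ∈ c.support, q.1.source = q.2.source ∧ q.2.length = N := fun q hq =>
    (Finsupp.mem_supported R c).1 hc hq
  refine ⟨c, hca.symm, fun q hq => ⟨(hc' q hq).1, fun g hg => ?_⟩⟩
  rw [← hca, Finsupp.sum, map_sum, Finset.sum_apply, Finset.sum_eq_single_of_mem q hq]
  · rw [ev_smul, ev_matUnit_of_mem hg, mul_one]
  · intro q' hq' hne
    rw [ev_smul, ev_matUnit (hc' q' hq').1, if_neg, mul_zero]
    intro hg'
    obtain ⟨h1, h2⟩ := cylinder_unique hg' hg ((hc' q' hq').2.trans (hc' q hq).2.symm)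
    exact hne (Prod.ext h1 h2)

/-- An element is determined by the function on the groupoid that it defines. -/
theorem ev_injective (hE : E.RowFinite) (hE' : E.NoSources) :
    Function.Injective (ev : LeavittPathAlgebra R E → E.GraphGroupoid → R) := by
  refine (injective_iff_map_eq_zero ev).2 fun a ha => ?_
  obtain ⟨c, hca, hc⟩ := exists_normalForm hE hE' a
  suffices c = 0 by rw [hca, this, Finsupp.sum_zero_index]
  by_contra hne
  obtain ⟨q, hq⟩ := Finsupp.support_nonempty_iff.2 hne
  obtain ⟨z, hz⟩ := hE'.exists_infPath q.2.source
  obtain ⟨g, hg, -⟩ := exists_mem_cylinder (hc q hq).1 z hz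
  exact Finsupp.mem_support_iff.1 hq (by rw [← (hc q hq).2 g hg, ha]; rfl)

/-- The diagonal consists of the elements supported on the units of the groupoid. -/
theorem mem_diagonal_iff (hE : E.RowFinite) (hE' : E.NoSources) {a : LeavittPathAlgebra R E} :
    a ∈ diagonal R E ↔ ∀ g, ev a g ≠ 0 → g = unit g.src := by
  classical
  constructor
  · intro ha g hg
    by_contra hne
    refine hg ?_
    clear hg
    induction ha using Submodule.span_induction with
    | mem a ha =>
      obtain ⟨μ, rfl⟩ := ha
      change ev (matUnit R μ μ) g = 0
      rw [ev_matUnit rfl, if_neg]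
      refine fun h => hne (eq_of_mem_cylinder_of_src h ?_ rfl)
      exact unit_mem_cylinder.2 (mem_cylinder.1 h).2.2.1
    | zero => exact ev_zero g
    | add a b _ _ ha hb => rw [ev_add, ha, hb, add_zero]
    | smul t a _ ha => rw [ev_smul, ha, mul_zero]
  · intro ha
    obtain ⟨c, hca, hc⟩ := exists_normalForm hE hE' a
    rw [hca]
    refine Submodule.sum_mem _ fun q hq => Submodule.smul_mem _ _ (Submodule.subset_span ?_)
    refine ⟨q.1, ?_⟩
    obtain ⟨z, hz⟩ := hE'.exists_infPath q.2.source
    obtain ⟨g, hg, -⟩ := exists_mem_cylinder (hc q hq).1 z hz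
    have hu := ha g (by rw [(hc q hq).2 g hg]; exact Finsupp.mem_support_iff.1 hq)
    have hm := mem_cylinder.1 hg
    have h1 : g.rng = g.src := congrArg GraphGroupoid.rng hu
    have h2 : g.lag = 0 := congrArg GraphGroupoid.lag hu
    have hl : q.1.length = q.2.length := by omega
    have : q.2 = q.1 := by rw [← hm.2.1, ← hm.2.2.1, hl, h1]
    change matUnit R q.1 q.2 = matUnit R q.1 q.1
    rw [this]

end Functions

end LeavittPathAlgebra

/-! ### From groupoid isomorphisms to algebra isomorphisms -/

namespace TopologicalGroupoidIso

open GraphGroupoid LeavittPathAlgebra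

variable {E : DirectedGraph.{u, v}} {F : DirectedGraph.{u', v'}}

/-- The inverse of an isomorphism of topological groupoids. -/
def symm (Φ : TopologicalGroupoidIso E F) : TopologicalGroupoidIso F E where
  toHomeomorph := Φ.toHomeomorph.symm
  composable_iff g h := by
    rw [Φ.composable_iff, Homeomorph.apply_symm_apply, Homeomorph.apply_symm_apply]
  map_comp g h hc := by
    rw [Homeomorph.symm_apply_eq, Φ.map_comp]
    exact comp_congr (by simp) (by simp) _ _

theorem map_unit (Φ : TopologicalGroupoidIso E F) (x : E.InfPath) :
    Φ.toHomeomorph (unit x) = unit (Φ.toHomeomorph (unit x)).src := by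
  refine eq_unit_of_comp_self ((Φ.composable_iff (unit x) (unit x)).1 rfl) ?_
  exact (Φ.map_comp (unit x) (unit x) rfl).symm.trans (congrArg _ (unit_comp (unit x)))

theorem eq_unit_iff (Φ : TopologicalGroupoidIso E F) (g : E.GraphGroupoid) :
    Φ.toHomeomorph g = unit (Φ.toHomeomorph g).src ↔ g = unit g.src := by
  constructor
  · intro h
    have h1 := Φ.symm.map_unit (Φ.toHomeomorph g).src
    rw [← h] at h1
    simpa [symm] using h1
  · intro h
    have h1 := Φ.map_unit g.src
    rwa [← h] at h1

theorem map_inv (Φ : TopologicalGroupoidIso E F) (g : E.GraphGroupoid) :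
    Φ.toHomeomorph g.inv = (Φ.toHomeomorph g).inv := by
  refine eq_inv_of_comp_eq_unit ((Φ.composable_iff g g.inv).1 rfl)
    (Φ.toHomeomorph (unit g.rng)).src ?_
  rw [← Φ.map_comp g g.inv rfl, comp_inv]
  exact Φ.map_unit _

theorem src_eq_iff (Φ : TopologicalGroupoidIso E F) (g h : E.GraphGroupoid) :
    g.src = h.src ↔ (Φ.toHomeomorph g).src = (Φ.toHomeomorph h).src := by
  have h1 := Φ.composable_iff g h.inv
  rwa [map_inv] at h1

variable {R : Type w} [CommRing R]

/-- Compactness argument for indicator functions: for a map `θ` between graph groupoids and a set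
`V`, the indicator function of `θ⁻¹(V ∩ Z(μ, ν))` comes from the Leavitt path algebra as soon as
this holds for all sufficiently small cylinder sets around every point of `Z(μ, ν)`. -/
theorem exists_ev_eq_indicator (hE : E.RowFinite) (θ : F.GraphGroupoid → E.GraphGroupoid)
    (V : Set E.GraphGroupoid) {μ ν : E.FinPath} (h : μ.source = ν.source)
    (hloc : ∀ g ∈ cylinder μ ν, ∃ N, ∀ α β : E.FinPath, N ≤ β.length → g ∈ cylinder α β →
      ∃ b : LeavittPathAlgebra R F, ∀ k, ev b k = (V ∩ cylinder α β).indicator 1 (θ k)) :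
    ∃ b : LeavittPathAlgebra R F, ∀ k, ev b k = (V ∩ cylinder μ ν).indicator 1 (θ k) := by
  refine cylinder_induction (fun α β => ∃ b : LeavittPathAlgebra R F, ∀ k,
    ev b k = (V ∩ cylinder α β).indicator 1 (θ k)) ?_ μ ν h ?_
  · intro α β hs hP
    choose b hb using hP
    have hr := fun e : (hE β.source).toFinset => (hE β.source).mem_toFinset.1 e.2
    refine ⟨∑ e ∈ (hE β.source).toFinset.attach, b e.1 (hr e), fun k => ?_⟩
    rw [map_sum, Finset.sum_apply]
    simp only [hb]
    by_cases hk : θ k ∈ V ∩ cylinder α β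
    · have he : E.r ((θ k).src.edge β.length) = β.source := by
        rw [← InfPath.source_take, (mem_cylinder.1 hk.2).2.2.1]
      rw [Set.indicator_of_mem hk, Finset.sum_eq_single_of_mem
        ⟨_, (hE β.source).mem_toFinset.2 he⟩ (Finset.mem_attach _ _)]
      · exact Set.indicator_of_mem (s := V ∩ cylinder _ _)
          ⟨hk.1, (mem_cylinder_snoc (he.trans hs.symm) he).2 ⟨hk.2, rfl⟩⟩ _
      · intro e _ hne
        refine Set.indicator_of_notMem (fun h => hne (Subtype.ext ?_)) _
        exact ((mem_cylinder_snoc _ _).1 h.2).2.symm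
    · rw [Set.indicator_of_notMem hk]
      refine Finset.sum_eq_zero fun e _ => Set.indicator_of_notMem (fun h => hk ⟨h.1, ?_⟩) _
      exact ((mem_cylinder_snoc _ _).1 h.2).1
  · intro g hg
    obtain ⟨N, hN⟩ := hloc g hg
    refine ⟨N, hN _ _ ?_ (mem_cylinder_take hg N)⟩
    rw [InfPath.length_take]
    omega

variable [StarRing R]

theorem ev_matUnit_eq_indicator {μ ν : E.FinPath} (h : μ.source = ν.source)
    (g : E.GraphGroupoid) : ev (matUnit R μ ν) g = (cylinder μ ν).indicator 1 g := by
  classical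
  rw [ev_matUnit h, Set.indicator_apply]
  rfl

/-- The indicator function of the intersection of a cylinder set and a clopen set comes from the
Leavitt path algebra. -/
theorem exists_ev_eq_indicator_of_isClopen (hE : E.RowFinite) {U : Set E.GraphGroupoid}
    (hU : IsClopen U) {μ ν : E.FinPath} (h : μ.source = ν.source) :
    ∃ b : LeavittPathAlgebra R E, ∀ k, ev b k = (U ∩ cylinder μ ν).indicator 1 k := by
  refine exists_ev_eq_indicator hE id U h fun g _ => ?_
  by_cases hgU : g ∈ U
  · obtain ⟨N, hN⟩ := exists_cylinder_subset hU.isOpen hgU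
    refine ⟨N, fun α β hl hg => ⟨matUnit R α β, fun k => ?_⟩⟩
    rw [ev_matUnit_eq_indicator (source_eq_of_mem hg),
      Set.inter_eq_self_of_subset_right (hN α β hl hg), id]
  · obtain ⟨N, hN⟩ := exists_cylinder_subset hU.compl.isOpen hgU
    refine ⟨N, fun α β hl hg => ⟨0, fun k => ?_⟩⟩
    rw [ev_zero, Set.indicator_of_notMem fun hk => hN α β hl hg hk.2 hk.1]

theorem exists_ev_eq_indicator_image (hE : E.RowFinite) (hF : F.RowFinite)
    (Φ : TopologicalGroupoidIso E F) {μ ν : E.FinPath} (h : μ.source = ν.source) :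
    ∃ b : LeavittPathAlgebra R F, ∀ k,
      ev b k = (cylinder μ ν).indicator 1 (Φ.toHomeomorph.symm k) := by
  have key := exists_ev_eq_indicator (R := R) hE Φ.toHomeomorph.symm Set.univ h
  simp only [Set.univ_inter] at key
  refine key fun g _ => ?_
  -- `Φ(Z(α, β))` lies in a cylinder set around `Φ(g)` when `Z(α, β)` is small
  obtain ⟨γ, δ, hγ⟩ := (Φ.toHomeomorph g).exists_cylinder
  obtain ⟨N, hN⟩ := exists_cylinder_subset (g := g)
    ((isOpen_cylinder γ δ).preimage Φ.toHomeomorph.continuous) hγ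
  refine ⟨N, fun α β hl hg => ?_⟩
  obtain ⟨b, hb⟩ := exists_ev_eq_indicator_of_isClopen (R := R) hF
    ((isClopen_cylinder α β).preimage Φ.toHomeomorph.symm.continuous) (source_eq_of_mem hγ)
  refine ⟨b, fun k => (hb k).trans ?_⟩
  rw [Set.inter_eq_self_of_subset_left]
  · rfl
  · intro k hk
    simpa using hN α β hl hg hk

/-- Transport of functions along a groupoid isomorphism preserves the functions which come from
the Leavitt path algebras. -/
theorem exists_transport (hE : E.RowFinite) (hF : F.RowFinite) (Φ : TopologicalGroupoidIso E F)
    (a : LeavittPathAlgebra R E) :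
    ∃ b : LeavittPathAlgebra R F, ∀ g, ev b (Φ.toHomeomorph g) = ev a g := by
  classical
  induction a using induction_matUnit with
  | h0 => exact ⟨0, fun g => by rw [ev_zero, ev_zero]⟩
  | hadd a b ha hb =>
    obtain ⟨a', ha⟩ := ha
    obtain ⟨b', hb⟩ := hb
    exact ⟨a' + b', fun g => by rw [ev_add, ev_add, ha, hb]⟩
  | hsmul t a ha =>
    obtain ⟨a', ha⟩ := ha
    exact ⟨t • a', fun g => by rw [ev_smul, ev_smul, ha]⟩
  | h μ ν h =>
    obtain ⟨b, hb⟩ := exists_ev_eq_indicator_image (R := R) hE hF Φ h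
    exact ⟨b, fun g => by rw [hb, ev_matUnit_eq_indicator h, Homeomorph.symm_apply_apply]⟩

theorem ev_mul_transport (Φ : TopologicalGroupoidIso E F) {a b : LeavittPathAlgebra R E}
    {a' b' : LeavittPathAlgebra R F} (ha : ∀ g, ev a' (Φ.toHomeomorph g) = ev a g)
    (hb : ∀ g, ev b' (Φ.toHomeomorph g) = ev b g) (g : E.GraphGroupoid) :
    ev (a' * b') (Φ.toHomeomorph g) = ev (a * b) g := by
  rw [ev_mul, ev_mul]
  let ε : {h : E.GraphGroupoid // g.src = h.src} ≃
      {h : F.GraphGroupoid // (Φ.toHomeomorph g).src = h.src} :=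
    Φ.toHomeomorph.toEquiv.subtypeEquiv fun h => Φ.src_eq_iff g h
  rw [← finsum_comp_equiv ε]
  refine finsum_congr fun h => ?_
  rw [← ha, ← hb]
  refine congrArg (· * ev b' (Φ.toHomeomorph h.1)) (congrArg (ev a') ?_)
  exact (comp_congr rfl (Φ.map_inv h.1).symm _ _).trans (Φ.map_comp g h.1.inv h.2).symm

/-- An isomorphism of graph groupoids induces a diagonal-preserving ring `*`-isomorphism of
Leavitt path algebras. -/
theorem exists_starRingEquiv (hE : E.RowFinite) (hE' : E.NoSources) (hF : F.RowFinite)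
    (hF' : F.NoSources) (Φ : TopologicalGroupoidIso E F) :
    ∃ π : LeavittPathAlgebra R E ≃⋆+* LeavittPathAlgebra R F,
      π '' (diagonal R E : Set (LeavittPathAlgebra R E)) =
        (diagonal R F : Set (LeavittPathAlgebra R F)) := by
  choose f hf using exists_transport (R := R) hE hF Φ
  choose f' hf' using exists_transport (R := R) hF hE Φ.symm
  have hunique : ∀ {a : LeavittPathAlgebra R E} {b : LeavittPathAlgebra R F},
      (∀ g, ev b (Φ.toHomeomorph g) = ev a g) → f a = b := by
    intro a b h
    refine ev_injective hF hF' (funext fun k => ?_)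
    obtain ⟨g, rfl⟩ := Φ.toHomeomorph.surjective k
    rw [hf, h]
  have hff' : ∀ b, f (f' b) = b := fun b => hunique fun g => by
    rw [← hf' b]
    exact congrArg (ev (f' b)) (Φ.toHomeomorph.symm_apply_apply g)
  have hinj : Function.Injective f := fun a b h => by
    refine ev_injective hE hE' (funext fun g => ?_)
    rw [← hf a, ← hf b, h]
  let π : LeavittPathAlgebra R E ≃⋆+* LeavittPathAlgebra R F :=
    { toFun := f
      invFun := f'
      left_inv := fun a => hinj (hff' _)
      right_inv := hff'
      map_mul' := fun a b => hunique (Φ.ev_mul_transport (hf a) (hf b))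
      map_add' := fun a b => hunique fun g => by rw [ev_add, ev_add, hf, hf]
      map_star' := fun a => hunique fun g => by rw [ev_star, ev_star, ← Φ.map_inv, hf] }
  refine ⟨π, ?_⟩
  have hπ : ∀ a, π a ∈ diagonal R F ↔ a ∈ diagonal R E := by
    intro a
    rw [mem_diagonal_iff hE hE', mem_diagonal_iff hF hF']
    constructor
    · intro h g hg
      exact (Φ.eq_unit_iff g).1 (h _ (by rwa [show π a = f a from rfl, hf]))
    · intro h k hk
      obtain ⟨g, rfl⟩ := Φ.toHomeomorph.surjective k
      exact (Φ.eq_unit_iff g).2 (h g (by rwa [show π a = f a from rfl, hf] at hk))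
  ext b
  constructor
  · rintro ⟨a, ha, rfl⟩
    exact (hπ a).2 ha
  · intro hb
    obtain ⟨a, rfl⟩ := π.surjective b
    exact ⟨a, (hπ a).1 hb, rfl⟩

end TopologicalGroupoidIso

namespace LeavittPathAlgebra

open GraphGroupoid

/-! ### Normalizers of the diagonal -/

section Normalizers

variable {R : Type w} [CommRing R] [StarRing R] {E : DirectedGraph.{u, v}}

theorem matUnit_self_mem_diagonal (μ : E.FinPath) : matUnit R μ μ ∈ diagonal R E :=
  Submodule.subset_span ⟨μ, rfl⟩

theorem matUnit_nil (v : E.Vert) :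
    matUnit R (FinPath.nil v) (FinPath.nil v) = p R E v :=
  (isLeavittFamily R E).idem v

theorem mem_cylinder_of_ev_ne_zero {μ ν : E.FinPath} (h : μ.source = ν.source)
    {g : E.GraphGroupoid} (hg : ev (matUnit R μ ν) g ≠ 0) : g ∈ cylinder μ ν := by
  classical
  by_contra hc
  exact hg (by rw [ev_matUnit h, if_neg hc])

theorem ev_matUnit_self_unit (x : E.InfPath) (n : ℕ) :
    ev (matUnit R (x.take n) (x.take n)) (unit x) = 1 :=
  ev_matUnit_of_mem (unit_mem_cylinder.2 (by rw [InfPath.length_take]))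

theorem ev_mul_diagonal (hE : E.RowFinite) (hE' : E.NoSources) (a : LeavittPathAlgebra R E)
    {d : LeavittPathAlgebra R E} (hd : d ∈ diagonal R E) (g : E.GraphGroupoid) :
    ev (a * d) g = ev a g * ev d (unit g.src) := by
  have hd' := (mem_diagonal_iff hE hE').1 hd
  have := ev_mul_comp (a := a) (b := d) g (unit g.src) rfl fun h₁ h₂ hc he _ h2 => by
    rw [hd' h₂ h2]
    exact congrArg unit (congrArg GraphGroupoid.src he :)
  rwa [comp_unit] at this

theorem ev_diagonal_mul (hE : E.RowFinite) (hE' : E.NoSources) (a : LeavittPathAlgebra R E)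
    {d : LeavittPathAlgebra R E} (hd : d ∈ diagonal R E) (g : E.GraphGroupoid) :
    ev (d * a) g = ev d (unit g.rng) * ev a g := by
  have hd' := (mem_diagonal_iff hE hE').1 hd
  have := ev_mul_comp (a := d) (b := a) (unit g.rng) g rfl fun h₁ h₂ hc he h1 _ => by
    rw [unit_comp] at he
    have hu := hd' h₁ h1
    have e1 : h₁.rng = h₁.src := congrArg GraphGroupoid.rng hu
    have e2 : h₁.lag = 0 := congrArg GraphGroupoid.lag hu
    have e3 : h₁.rng = g.rng := (congrArg GraphGroupoid.rng he :)
    have e4 : h₁.lag + h₂.lag = g.lag := congrArg GraphGroupoid.lag he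
    exact GraphGroupoid.ext (by rw [← hc, ← e1, e3]) (by omega)
      (congrArg GraphGroupoid.src he :)
  rwa [unit_comp] at this

theorem mul_mem_diagonal (hE : E.RowFinite) (hE' : E.NoSources) {d d' : LeavittPathAlgebra R E}
    (hd : d ∈ diagonal R E) (hd' : d' ∈ diagonal R E) : d * d' ∈ diagonal R E := by
  refine (mem_diagonal_iff hE hE').2 fun g hg => (mem_diagonal_iff hE hE').1 hd g fun h => hg ?_
  rw [ev_mul_diagonal hE hE' d hd', h, zero_mul]

theorem star_mem_diagonal {d : LeavittPathAlgebra R E} (hd : d ∈ diagonal R E) :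
    star d ∈ diagonal R E := by
  induction hd using Submodule.span_induction with
  | mem a ha =>
    obtain ⟨μ, rfl⟩ := ha
    rw [star_mul, star_star]
    exact matUnit_self_mem_diagonal μ
  | zero => rw [star_zero]; exact zero_mem _
  | add a b _ _ ha hb => rw [star_add]; exact add_mem ha hb
  | smul t a _ ha => rw [star_smul]; exact Submodule.smul_mem _ _ ha

/-- Elements of the diagonal are determined by their values at the units. -/
theorem diagonal_ext (hE : E.RowFinite) (hE' : E.NoSources) {d d' : LeavittPathAlgebra R E}
    (hd : d ∈ diagonal R E) (hd' : d' ∈ diagonal R E)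
    (h : ∀ x, ev d (unit x) = ev d' (unit x)) : d = d' := by
  refine ev_injective hE hE' (funext fun g => ?_)
  by_cases hg : g = unit g.src
  · rw [hg, h]
  · rw [not_not.1 (mt ((mem_diagonal_iff hE hE').1 hd g) hg),
      not_not.1 (mt ((mem_diagonal_iff hE hE').1 hd' g) hg)]

/-- Near a point `x`, an element of the diagonal is a multiple of an indicator function. -/
theorem exists_diagonal_mul_matUnit (hE : E.RowFinite) (hE' : E.NoSources)
    {d : LeavittPathAlgebra R E} (hd : d ∈ diagonal R E) (x : E.InfPath) :
    ∃ n, d * matUnit R (x.take n) (x.take n) =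
      ev d (unit x) • matUnit R (x.take n) (x.take n) := by
  classical
  obtain ⟨N, hN⟩ := exists_locallyConstant d
  have hm := matUnit_self_mem_diagonal (R := R) (x.take N)
  refine ⟨N, diagonal_ext hE hE' (mul_mem_diagonal hE hE' hd hm)
    (Submodule.smul_mem _ _ hm) fun y => ?_⟩
  rw [ev_mul_diagonal hE hE' d hm, ev_smul]
  change ev d (unit y) * ev _ (unit y) = _
  rw [ev_matUnit rfl]
  split_ifs with h
  · rw [hN _ _ (by rw [InfPath.length_take]) _ h (unit x)
      (unit_mem_cylinder.2 (by rw [InfPath.length_take]))]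
  · rw [mul_zero, mul_zero]

/-- The normalizers of the diagonal. -/
def IsNormalizer (n : LeavittPathAlgebra R E) : Prop :=
  ∀ d ∈ diagonal R E, n * d * star n ∈ diagonal R E ∧ star n * d * n ∈ diagonal R E

theorem IsNormalizer.star {n : LeavittPathAlgebra R E} (hn : IsNormalizer n) :
    IsNormalizer (star n) := by
  intro d hd
  rw [star_star]
  exact (hn d hd).symm

theorem IsNormalizer.mul {m n : LeavittPathAlgebra R E} (hm : IsNormalizer m)
    (hn : IsNormalizer n) : IsNormalizer (m * n) := by
  intro d hd
  have h1 := (hm _ (hn d hd).1).1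
  have h2 := (hn _ (hm d hd).2).2
  rw [star_mul]
  simp only [mul_assoc] at h1 h2 ⊢
  exact ⟨h1, h2⟩

theorem isNormalizer_of_mem_diagonal (hE : E.RowFinite) (hE' : E.NoSources)
    {d : LeavittPathAlgebra R E} (hd : d ∈ diagonal R E) : IsNormalizer d := fun _ hd' =>
  ⟨mul_mem_diagonal hE hE' (mul_mem_diagonal hE hE' hd hd') (star_mem_diagonal hd),
    mul_mem_diagonal hE hE' (mul_mem_diagonal hE hE' (star_mem_diagonal hd) hd') hd⟩

theorem conj_mem_diagonal (hE : E.RowFinite) (hE' : E.NoSources) {n : LeavittPathAlgebra R E}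
    (hn : ∀ g h : E.GraphGroupoid, ev n g ≠ 0 → ev n h ≠ 0 → g.src = h.src → g = h)
    {d : LeavittPathAlgebra R E} (hd : d ∈ diagonal R E) : n * d * star n ∈ diagonal R E := by
  refine (mem_diagonal_iff hE hE').2 fun g hg => ?_
  obtain ⟨g₁, g₂, hc, rfl, h1, h2⟩ := exists_of_ev_mul_ne_zero hg
  rw [ev_mul_diagonal hE hE' n hd] at h1
  rw [ev_star, star_ne_zero] at h2
  obtain rfl := hn g₁ g₂.inv (left_ne_zero_of_mul h1) h2 hc
  exact inv_comp g₂

theorem isNormalizer_matUnit (hE : E.RowFinite) (hE' : E.NoSources) {μ ν : E.FinPath}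
    (h : μ.source = ν.source) : IsNormalizer (matUnit R μ ν) := by
  have key : ∀ {α β : E.FinPath}, α.source = β.source → ∀ d ∈ diagonal R E,
      matUnit R α β * d * star (matUnit R α β) ∈ diagonal R E := by
    intro α β hs d hd
    refine conj_mem_diagonal hE hE' (fun f g hf hg => ?_) hd
    exact eq_of_mem_cylinder_of_src (mem_cylinder_of_ev_ne_zero hs hf)
      (mem_cylinder_of_ev_ne_zero hs hg)
  refine fun d hd => ⟨key h d hd, ?_⟩
  have := key h.symm d hd
  rwa [star_matUnit] at this ⊢

variable [IsDomain R]

/-- The support of a normalizer contains at most one element with given source. If there were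
two, choose such `a ≠ b` with `a` of maximal and `b` of minimal lag. As `R` is a domain, some
`n d n*` with `d` in the diagonal is nonzero at `a b⁻¹`, which is not a unit. -/
theorem IsNormalizer.eq_of_src (hE : E.RowFinite) (hE' : E.NoSources)
    {n : LeavittPathAlgebra R E} (hn : IsNormalizer n) {g h : E.GraphGroupoid}
    (hg : ev n g ≠ 0) (hh : ev n h ≠ 0) (hs : g.src = h.src) : g = h := by
  by_contra hne
  let S : Set E.GraphGroupoid := {f | f.src = g.src ∧ ev n f ≠ 0}
  have hgS : g ∈ S := ⟨rfl, hg⟩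
  have hhS : h ∈ S := ⟨hs.symm, hh⟩
  obtain ⟨a, b, haS, hbS, hab, hmax, hmin⟩ : ∃ a b, a ∈ S ∧ b ∈ S ∧ a ≠ b ∧
      (∀ f ∈ S, f.lag ≤ a.lag) ∧ ∀ f ∈ S, b.lag ≤ f.lag := by
    have hfin : S.Finite := finite_setOf_src n g.src
    obtain ⟨a, ha, hmax⟩ := Set.exists_max_image S GraphGroupoid.lag hfin ⟨g, hgS⟩
    obtain ⟨b, hb, hmin⟩ := Set.exists_min_image S GraphGroupoid.lag hfin ⟨g, hgS⟩
    by_cases hab : a = b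
    · subst hab
      exact ⟨g, h, hgS, hhS, hne,
        fun f hf => (hmax f hf).trans (hmin g hgS), fun f hf => (hmax h hhS).trans (hmin f hf)⟩
    · exact ⟨a, b, ha, hb, hab, hmax, hmin⟩
  -- a neighbourhood of `y` which contains no other source of an element of the support with the
  -- range of `a`
  obtain ⟨N, hN⟩ : ∃ N, ∀ f : E.GraphGroupoid, f.rng = a.rng → ev n f ≠ 0 →
      f.src.take N = g.src.take N → f.src = g.src := by
    have hfin := finite_setOf_rng n a.rng
    have hex : ∀ f : E.GraphGroupoid, ∃ N, ∀ k, N ≤ k → f.src.take k = g.src.take k →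
        f.src = g.src := by
      intro f
      by_cases hf : f.src = g.src
      · exact ⟨0, fun _ _ _ => hf⟩
      · obtain ⟨N, hN⟩ := InfPath.exists_take_ne hf
        exact ⟨N, fun k hk hk' => absurd hk' (hN k hk)⟩
    choose N hN using hex
    refine ⟨hfin.toFinset.sup N, fun f hf hf' => hN f _ ?_⟩
    exact Finset.le_sup (f := N) (hfin.mem_toFinset.2 ⟨hf, hf'⟩)
  have hd := matUnit_self_mem_diagonal (R := R) (g.src.take N)
  have hc : a.src = b.inv.rng := haS.1.trans hbS.1.symm
  have hprod := ev_mul_comp (a := n * matUnit R (g.src.take N) (g.src.take N)) (b := Star.star n)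
    a b.inv hc fun h₁ h₂ hc' he h1 h2 => by
      rw [ev_mul_diagonal hE hE' n hd] at h1
      rw [ev_star, star_ne_zero] at h2
      have e1 : h₁.rng = a.rng := (congrArg GraphGroupoid.rng he :)
      have e2 : h₁.lag + h₂.lag = a.lag + -b.lag := congrArg GraphGroupoid.lag he
      have e3 : h₂.src = b.rng := (congrArg GraphGroupoid.src he :)
      have e4 : h₁.src.take N = g.src.take N := by
        have := unit_mem_cylinder.1
          (mem_cylinder_of_ev_ne_zero rfl (right_ne_zero_of_mul h1))
        rwa [InfPath.length_take] at this
      have e5 : h₁.src = g.src := hN h₁ e1 (left_ne_zero_of_mul h1) e4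
      have e6 := hmax h₁ ⟨e5, left_ne_zero_of_mul h1⟩
      have e7 : b.lag ≤ -h₂.lag := hmin h₂.inv ⟨hc'.symm.trans e5, h2⟩
      exact GraphGroupoid.ext (hc'.symm.trans (e5.trans hbS.1.symm))
        (by change h₂.lag = -b.lag; omega) e3
  have hne0 : ev (n * matUnit R (g.src.take N) (g.src.take N) * Star.star n)
      (a.comp b.inv hc) ≠ 0 := by
    rw [hprod, ev_mul_diagonal hE hE' n hd, haS.1, ev_matUnit_self_unit, mul_one, ev_star,
      inv_of_inv]
    exact mul_ne_zero haS.2 (star_ne_zero.2 hbS.2)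
  have hu := (mem_diagonal_iff hE hE').1 (hn _ hd).1 _ hne0
  have h1 : a.rng = b.rng := (congrArg GraphGroupoid.rng hu :)
  have h2 : a.lag + -b.lag = 0 := congrArg GraphGroupoid.lag hu
  exact hab (GraphGroupoid.ext h1 (by omega) hc)

theorem IsNormalizer.eq_of_rng (hE : E.RowFinite) (hE' : E.NoSources)
    {n : LeavittPathAlgebra R E} (hn : IsNormalizer n) {g h : E.GraphGroupoid}
    (hg : ev n g ≠ 0) (hh : ev n h ≠ 0) (hs : g.rng = h.rng) : g = h := by
  have key : ∀ {f : E.GraphGroupoid}, ev n f ≠ 0 → ev (Star.star n) f.inv ≠ 0 := fun hf => by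
    rwa [ev_star, star_ne_zero, inv_of_inv]
  have := hn.star.eq_of_src hE hE' (key hg) (key hh) hs
  rw [← inv_of_inv g, this, inv_of_inv]

theorem IsNormalizer.star_mul_self_mem (hE : E.RowFinite) (hE' : E.NoSources)
    {n : LeavittPathAlgebra R E} (hn : IsNormalizer n) : Star.star n * n ∈ diagonal R E := by
  refine (mem_diagonal_iff hE hE').2 fun g hg => ?_
  obtain ⟨g₁, g₂, hc, rfl, h1, h2⟩ := exists_of_ev_mul_ne_zero hg
  rw [ev_star, star_ne_zero] at h1
  obtain rfl := hn.eq_of_rng hE hE' h1 h2 hc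
  exact comp_inv g₁

/-- The product of normalizers is computed pointwise. -/
theorem IsNormalizer.ev_mul (hE : E.RowFinite) (hE' : E.NoSources)
    {m n : LeavittPathAlgebra R E} (hn : IsNormalizer n)
    {g h : E.GraphGroupoid} (hc : g.src = h.rng) (hh : ev n h ≠ 0) :
    ev (m * n) (g.comp h hc) = ev m g * ev n h :=
  ev_mul_comp g h hc fun _ _ _ he _ h2 =>
    hn.eq_of_src hE hE' h2 hh (congrArg GraphGroupoid.src he :)

/-- Near an element `g` of its support, a normalizer is a multiple of the indicator function of
a cylinder set. -/
theorem IsNormalizer.exists_eq_indicator (hE : E.RowFinite) (hE' : E.NoSources)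
    {n : LeavittPathAlgebra R E} (hn : IsNormalizer n) {g : E.GraphGroupoid} (hg : ev n g ≠ 0) :
    ∃ K, ∀ α β : E.FinPath, K ≤ β.length → g ∈ cylinder α β → ∀ f : E.GraphGroupoid,
      f.src.take β.length = β → ev n f = (cylinder α β).indicator (fun _ => ev n g) f := by
  obtain ⟨N, hN⟩ := exists_locallyConstant n
  obtain ⟨M, hM⟩ := exists_cylinder_of_support n
  refine ⟨max N M, fun α β hl hgc f hf => ?_⟩
  by_cases hfc : f ∈ cylinder α β
  · rw [Set.indicator_of_mem hfc]
    exact hN α β (by omega) f hfc g hgc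
  · rw [Set.indicator_of_notMem hfc]
    by_contra hf0
    obtain ⟨α', β', hl', hf'⟩ := hM β.length (by omega) f hf0
    obtain rfl : β' = β := by rw [← (mem_cylinder.1 hf').2.2.1, hl', hf]
    have hgβ := (mem_cylinder.1 hgc).2.2.1
    -- move `f` within its cylinder set to an element with the source of `g`
    obtain ⟨f', hf'c, hf'd⟩ := exists_mem_cylinder (source_eq_of_mem hf') (g.src.drop β'.length)
      (by rw [InfPath.range_drop, hgβ])
    have hs : f'.src = g.src :=
      InfPath.ext_take_drop ((mem_cylinder.1 hf'c).2.2.1.trans hgβ.symm) hf'd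
    have h0 : ev n f' ≠ 0 := by rwa [hN α' β' (by omega) f' hf'c f hf']
    obtain rfl := hn.eq_of_src hE hE' h0 hg hs
    obtain ⟨rfl, -⟩ := cylinder_unique hf'c hgc rfl
    exact hfc hf'

/-- Two normalizers whose supports meet in `g` are proportional near the source of `g`. -/
theorem IsNormalizer.exists_mul_eq_mul (hE : E.RowFinite) (hE' : E.NoSources)
    {m n : LeavittPathAlgebra R E} (hm : IsNormalizer m) (hn : IsNormalizer n)
    {g : E.GraphGroupoid} (hmg : ev m g ≠ 0) (hng : ev n g ≠ 0) :
    ∃ β : E.FinPath, g.src.take β.length = β ∧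
      m * (ev n g • matUnit R β β) = n * (ev m g • matUnit R β β) := by
  classical
  obtain ⟨K, hK⟩ := hm.exists_eq_indicator hE hE' hmg
  obtain ⟨L, hL⟩ := hn.exists_eq_indicator hE hE' hng
  obtain ⟨M, hM⟩ := g.exists_cylinder_length
  obtain ⟨α, β, hl, hg⟩ := hM (max M (max K L)) (by omega)
  refine ⟨β, (mem_cylinder.1 hg).2.2.1, ev_injective hE hE' (funext fun f => ?_)⟩
  have hd := matUnit_self_mem_diagonal (R := R) β
  rw [ev_mul_diagonal hE hE' m (Submodule.smul_mem _ _ hd),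
    ev_mul_diagonal hE hE' n (Submodule.smul_mem _ _ hd), ev_smul, ev_smul, ev_matUnit rfl]
  by_cases hf : f.src.take β.length = β
  · rw [if_pos (unit_mem_cylinder.2 hf), hK α β (by omega) hg f hf, hL α β (by omega) hg f hf]
    by_cases hfc : f ∈ cylinder α β
    · rw [Set.indicator_of_mem hfc, Set.indicator_of_mem hfc]
      ring
    · rw [Set.indicator_of_notMem hfc, Set.indicator_of_notMem hfc, zero_mul, zero_mul]
  · rw [if_neg (mt unit_mem_cylinder.1 hf), mul_zero, mul_zero, mul_zero, mul_zero]

end Normalizers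

/-! ### From algebra isomorphisms to groupoid isomorphisms -/

section Reconstruction

variable {R : Type w} [CommRing R] [StarRing R]
  {E : DirectedGraph.{u, v}} {F : DirectedGraph.{u', v'}}
  (π : LeavittPathAlgebra R E ≃⋆+* LeavittPathAlgebra R F)

/-- The correspondence of infinite paths which a diagonal-preserving isomorphism `π` induces:
`d` vanishes at `x` if and only if `π(d)` vanishes at `y`. -/
def PointRel (x : E.InfPath) (y : F.InfPath) : Prop :=
  ∀ d ∈ diagonal R E, ev d (unit x) ≠ 0 ↔ ev (π d) (unit y) ≠ 0

/-- The correspondence of groupoid elements which a diagonal-preserving isomorphism `π` induces: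
a normalizer `n` vanishes at `g` if and only if `π(n)` vanishes at `h`. -/
def GroupoidRel (g : E.GraphGroupoid) (h : F.GraphGroupoid) : Prop :=
  ∀ n : LeavittPathAlgebra R E, IsNormalizer n → (ev n g ≠ 0 ↔ ev (π n) h ≠ 0)

variable {π}

theorem symm_mem_diagonal_iff (hπ : ∀ a, π a ∈ diagonal R F ↔ a ∈ diagonal R E)
    (b : LeavittPathAlgebra R F) : π.symm b ∈ diagonal R E ↔ b ∈ diagonal R F := by
  rw [← hπ, π.apply_symm_apply]

theorem IsNormalizer.map (hπ : ∀ a, π a ∈ diagonal R F ↔ a ∈ diagonal R E)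
    {n : LeavittPathAlgebra R E} (hn : IsNormalizer n) : IsNormalizer (π n) := by
  intro d hd
  have h := hn _ ((symm_mem_diagonal_iff hπ d).2 hd)
  rw [← hπ, ← hπ] at h
  simpa only [map_mul, map_star, π.apply_symm_apply] using h

theorem PointRel.symm (hπ : ∀ a, π a ∈ diagonal R F ↔ a ∈ diagonal R E) {x : E.InfPath}
    {y : F.InfPath} (h : PointRel π x y) : PointRel π.symm y x := by
  intro d hd
  have := h _ ((symm_mem_diagonal_iff hπ d).2 hd)
  rw [π.apply_symm_apply] at this
  exact this.symm

theorem GroupoidRel.symm (hπ : ∀ a, π a ∈ diagonal R F ↔ a ∈ diagonal R E)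
    {g : E.GraphGroupoid} {h : F.GraphGroupoid} (hgh : GroupoidRel π g h) :
    GroupoidRel π.symm h g := by
  intro n hn
  have := hgh _ (hn.map (symm_mem_diagonal_iff hπ))
  rw [π.apply_symm_apply] at this
  exact this.symm

variable [IsDomain R]

theorem PointRel.eq (hπ : ∀ a, π a ∈ diagonal R F ↔ a ∈ diagonal R E) {x : E.InfPath}
    {y y' : F.InfPath} (h : PointRel π x y) (h' : PointRel π x y') : y = y' := by
  refine InfPath.ext_of_take fun n => ?_
  have hd := matUnit_self_mem_diagonal (R := R) (y.take n)
  have h1 := (h.symm hπ) _ hd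
  have h2 := (h'.symm hπ) _ hd
  have h3 := h2.2 (h1.1 (by rw [ev_matUnit_self_unit]; exact one_ne_zero))
  have h4 := unit_mem_cylinder.1 (mem_cylinder_of_ev_ne_zero rfl h3)
  rw [InfPath.length_take] at h4
  exact h4.symm

/-- Every infinite path has a counterpart. The finite paths `μ` for which the preimage of
`s_μ s_μ*` does not vanish at `x` can always be prolonged, and so are the initial segments of an
infinite path. -/
theorem exists_pointRel (hE : E.RowFinite) (hE' : E.NoSources) (hF : F.RowFinite)
    (hF' : F.NoSources) (hπ : ∀ a, π a ∈ diagonal R F ↔ a ∈ diagonal R E) (x : E.InfPath) :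
    ∃ y, PointRel π x y := by
  have hπ' := symm_mem_diagonal_iff hπ
  have hmul : ∀ (a b : LeavittPathAlgebra R F), b ∈ diagonal R F →
      ev (π.symm (a * b)) (unit x) =
        ev (π.symm a) (unit x) * ev (π.symm b) (unit x) := by
    intro a b hb
    rw [map_mul, ev_mul_diagonal hE hE' _ ((hπ' b).2 hb)]
    rfl
  let Q : F.FinPath → Prop := fun μ => ev (π.symm (matUnit R μ μ)) (unit x) ≠ 0
  have hQ : ∀ μ, Q μ → ∃ (e : F.Edge) (h : F.r e = μ.source), Q (μ.snoc e h) := by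
    intro μ hμ
    change ev (π.symm (matUnit R μ μ)) (unit x) ≠ 0 at hμ
    rw [matUnit_eq_sum hF hF' rfl, map_sum, map_sum, Finset.sum_apply] at hμ
    obtain ⟨e, -, he⟩ := Finset.exists_ne_zero_of_sum_ne_zero hμ
    exact ⟨e.1, _, he⟩
  obtain ⟨v, hv⟩ : ∃ v, Q (FinPath.nil v) := by
    by_contra! hc
    have hzero : ∀ d ∈ diagonal R F, ∀ t : R, ev (π.symm (t • d)) (unit x) = 0 := by
      intro d hd
      induction hd using Submodule.span_induction with
      | mem a ha =>
        intro t
        obtain ⟨μ, rfl⟩ := ha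
        change ev (π.symm (t • matUnit R μ μ)) (unit x) = 0
        rw [← matUnit_mul_p, ← smul_mul_assoc, ← matUnit_nil,
          hmul _ _ (matUnit_self_mem_diagonal _), not_not.1 (hc μ.range), mul_zero]
      | zero => intro t; rw [smul_zero, map_zero, ev_zero]
      | add a b _ _ ha hb => intro t; rw [smul_add, map_add, ev_add, ha, hb, add_zero]
      | smul s a _ ha => intro t; rw [smul_smul, ha]
    have h1 := hzero _ ((hπ _).2 (matUnit_self_mem_diagonal (R := R) (x.take 0))) 1
    rw [one_smul, π.symm_apply_apply, ev_matUnit_self_unit] at h1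
    exact one_ne_zero h1
  obtain ⟨y, -, hy⟩ := exists_infPath_of_extend Q hQ _ hv
  have hy' : ∀ n, Q (y.take n) := fun n => by
    have := hy n
    rwa [show (FinPath.nil v : F.FinPath).length = 0 from rfl, zero_add] at this
  have h1 : ∀ d ∈ diagonal R F, ev d (unit y) = 0 → ev (π.symm d) (unit x) = 0 := by
    intro d hd h0
    obtain ⟨n, hn⟩ := exists_diagonal_mul_matUnit hF hF' hd y
    have h2 := hmul d _ (matUnit_self_mem_diagonal (R := R) (y.take n))
    rw [hn, h0, zero_smul, map_zero, ev_zero] at h2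
    exact (mul_eq_zero.1 h2.symm).resolve_right (hy' n)
  have h2 : ∀ d ∈ diagonal R E, ev d (unit x) = 0 → ev (π d) (unit y) = 0 := by
    intro d hd h0
    obtain ⟨n, hn⟩ := exists_diagonal_mul_matUnit hE hE' hd x
    have hm := matUnit_self_mem_diagonal (R := R) (x.take n)
    have h3 := ev_mul_diagonal hF hF' (π d) ((hπ _).2 hm) (unit y)
    rw [← map_mul, hn, h0, zero_smul, map_zero, ev_zero] at h3
    refine (mul_eq_zero.1 h3.symm).resolve_right fun h4 => ?_
    have h5 := h1 _ ((hπ _).2 hm) h4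
    rw [π.symm_apply_apply, ev_matUnit_self_unit] at h5
    exact one_ne_zero h5
  refine ⟨y, fun d hd => not_congr ⟨h2 d hd, fun h => ?_⟩⟩
  have := h1 _ ((hπ d).2 hd) h
  rwa [π.symm_apply_apply] at this

/-- Whether `h` lies in the support of `π(n)` is the same for all normalizers `n` with `g` in
their support, if the sources of `g` and `h` correspond to each other. -/
theorem PointRel.ev_map_ne_zero (hE : E.RowFinite) (hE' : E.NoSources) (hF : F.RowFinite)
    (hF' : F.NoSources) (hπ : ∀ a, π a ∈ diagonal R F ↔ a ∈ diagonal R E)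
    {g : E.GraphGroupoid} {h : F.GraphGroupoid} (hs : PointRel π g.src h.src)
    {m n : LeavittPathAlgebra R E} (hm : IsNormalizer m) (hn : IsNormalizer n)
    (hmg : ev m g ≠ 0) (hng : ev n g ≠ 0) (hmh : ev (π m) h ≠ 0) : ev (π n) h ≠ 0 := by
  obtain ⟨β, hβ, he⟩ := hm.exists_mul_eq_mul hE hE' hn hmg hng
  have hd := matUnit_self_mem_diagonal (R := R) β
  have h1 : ∀ t : R, t ≠ 0 → ev (π (t • matUnit R β β)) (unit h.src) ≠ 0 := by
    intro t ht
    refine (hs _ (Submodule.smul_mem _ t hd)).1 ?_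
    rwa [ev_smul, ev_matUnit_of_mem (unit_mem_cylinder.2 hβ), mul_one]
  have h2 := congrArg (fun a => ev (π a) h) he
  simp only [map_mul] at h2
  rw [ev_mul_diagonal hF hF' _ ((hπ _).2 (Submodule.smul_mem _ _ hd)),
    ev_mul_diagonal hF hF' _ ((hπ _).2 (Submodule.smul_mem _ _ hd))] at h2
  exact left_ne_zero_of_mul (h2 ▸ mul_ne_zero hmh (h1 _ hng))

theorem exists_groupoidRel (hE : E.RowFinite) (hE' : E.NoSources) (hF : F.RowFinite)
    (hF' : F.NoSources) (hπ : ∀ a, π a ∈ diagonal R F ↔ a ∈ diagonal R E)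
    (g : E.GraphGroupoid) : ∃ h, GroupoidRel π g h := by
  have hπ' := symm_mem_diagonal_iff hπ
  obtain ⟨y, hy⟩ := exists_pointRel hE hE' hF hF' hπ g.src
  obtain ⟨μ, ν, hg⟩ := g.exists_cylinder
  have hm : IsNormalizer (matUnit R μ ν) := isNormalizer_matUnit hE hE' (source_eq_of_mem hg)
  have hmg : ev (matUnit R μ ν) g ≠ 0 := by rw [ev_matUnit_of_mem hg]; exact one_ne_zero
  have h1 : ev (star (matUnit R μ ν) * matUnit R μ ν) (unit g.src) ≠ 0 := by
    have h2 := hm.ev_mul hE hE' (m := star (matUnit R μ ν)) (g := g.inv) rfl hmg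
    rw [inv_comp, ev_star, inv_of_inv] at h2
    rw [h2]
    exact mul_ne_zero (star_ne_zero.2 hmg) hmg
  have h2 := (hy _ (hm.star_mul_self_mem hE hE')).1 h1
  rw [map_mul] at h2
  obtain ⟨h', h, hc, hu, -, hmh⟩ := exists_of_ev_mul_ne_zero h2
  obtain rfl : h.src = y := congrArg GraphGroupoid.src hu
  refine ⟨h, fun n hn => ⟨fun hng => ?_, fun hnh => ?_⟩⟩
  · exact hy.ev_map_ne_zero hE hE' hF hF' hπ hm hn hmg hng hmh
  · have := (hy.symm hπ).ev_map_ne_zero hF hF' hE hE' hπ' (hm.map hπ) (hn.map hπ) hmh hnh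
    simp only [π.symm_apply_apply] at this
    exact this hmg

variable {g : E.GraphGroupoid} {h : F.GraphGroupoid}

theorem exists_isNormalizer_ev_ne_zero (hE : E.RowFinite) (hE' : E.NoSources)
    (g : E.GraphGroupoid) : ∃ n : LeavittPathAlgebra R E, IsNormalizer n ∧ ev n g ≠ 0 := by
  obtain ⟨μ, ν, hg⟩ := g.exists_cylinder
  refine ⟨matUnit R μ ν, isNormalizer_matUnit hE hE' (source_eq_of_mem hg), ?_⟩
  rw [ev_matUnit_of_mem hg]
  exact one_ne_zero

theorem GroupoidRel.src (hE : E.RowFinite) (hE' : E.NoSources) (hF : F.RowFinite)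
    (hF' : F.NoSources) (hπ : ∀ a, π a ∈ diagonal R F ↔ a ∈ diagonal R E)
    (hgh : GroupoidRel π g h) : PointRel π g.src h.src := by
  obtain ⟨n, hn, hng⟩ := exists_isNormalizer_ev_ne_zero (R := R) hE hE' g
  intro d hd
  have h1 := hgh _ (hn.mul (isNormalizer_of_mem_diagonal hE hE' hd))
  rw [map_mul π, ev_mul_diagonal hE hE' n hd, ev_mul_diagonal hF hF' _ ((hπ d).2 hd),
    mul_ne_zero_iff, mul_ne_zero_iff, ← hgh n hn] at h1
  exact ⟨fun h2 => (h1.1 ⟨hng, h2⟩).2, fun h2 => (h1.2 ⟨hng, h2⟩).2⟩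

theorem GroupoidRel.rng (hE : E.RowFinite) (hE' : E.NoSources) (hF : F.RowFinite)
    (hF' : F.NoSources) (hπ : ∀ a, π a ∈ diagonal R F ↔ a ∈ diagonal R E)
    (hgh : GroupoidRel π g h) : PointRel π g.rng h.rng := by
  obtain ⟨n, hn, hng⟩ := exists_isNormalizer_ev_ne_zero (R := R) hE hE' g
  intro d hd
  have h1 := hgh _ ((isNormalizer_of_mem_diagonal hE hE' hd).mul hn)
  rw [map_mul π, ev_diagonal_mul hE hE' n hd, ev_diagonal_mul hF hF' _ ((hπ d).2 hd),
    mul_ne_zero_iff, mul_ne_zero_iff, ← hgh n hn] at h1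
  exact ⟨fun h2 => (h1.1 ⟨h2, hng⟩).1, fun h2 => (h1.2 ⟨h2, hng⟩).1⟩

theorem GroupoidRel.eq (hE : E.RowFinite) (hE' : E.NoSources) (hF : F.RowFinite)
    (hF' : F.NoSources) (hπ : ∀ a, π a ∈ diagonal R F ↔ a ∈ diagonal R E)
    {h' : F.GraphGroupoid} (hgh : GroupoidRel π g h) (hgh' : GroupoidRel π g h') : h = h' := by
  obtain ⟨n, hn, hng⟩ := exists_isNormalizer_ev_ne_zero (R := R) hE hE' g
  exact (hn.map hπ).eq_of_src hF hF' ((hgh n hn).1 hng) ((hgh' n hn).1 hng)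
    ((hgh.src hE hE' hF hF' hπ).eq hπ (hgh'.src hE hE' hF hF' hπ))

theorem GroupoidRel.comp (hE : E.RowFinite) (hE' : E.NoSources) (hF : F.RowFinite)
    (hF' : F.NoSources) (hπ : ∀ a, π a ∈ diagonal R F ↔ a ∈ diagonal R E)
    {g' : E.GraphGroupoid} {h' k : F.GraphGroupoid} (hgh : GroupoidRel π g h)
    (hgh' : GroupoidRel π g' h') (hc : g.src = g'.rng) (hc' : h.src = h'.rng)
    (hk : GroupoidRel π (g.comp g' hc) k) : k = h.comp h' hc' := by
  obtain ⟨n, hn, hng⟩ := exists_isNormalizer_ev_ne_zero (R := R) hE hE' g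
  obtain ⟨n', hn', hng'⟩ := exists_isNormalizer_ev_ne_zero (R := R) hE hE' g'
  have h1 : ev (n * n') (g.comp g' hc) ≠ 0 := by
    rw [hn'.ev_mul hE hE' hc hng']
    exact mul_ne_zero hng hng'
  have h2 : ev (π (n * n')) (h.comp h' hc') ≠ 0 := by
    rw [map_mul, (hn'.map hπ).ev_mul hF hF' hc' ((hgh' n' hn').1 hng')]
    exact mul_ne_zero ((hgh n hn).1 hng) ((hgh' n' hn').1 hng')
  refine ((hn.mul hn').map hπ).eq_of_src hF hF' ((hk _ (hn.mul hn')).1 h1) h2 ?_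
  have hs : PointRel π (g.comp g' hc).src h'.src := (hgh'.src hE hE' hF hF' hπ :)
  exact (hk.src hE hE' hF hF' hπ).eq hπ hs

theorem continuous_of_groupoidRel (hF : F.RowFinite) (hF' : F.NoSources)
    (hπ : ∀ a, π a ∈ diagonal R F ↔ a ∈ diagonal R E) (φ : E.GraphGroupoid → F.GraphGroupoid)
    (hφ : ∀ g, GroupoidRel π g (φ g)) : Continuous φ := by
  classical
  refine continuous_generateFrom_iff.2 ?_
  rintro _ ⟨μ, ν, h, rfl⟩
  convert isOpen_support (π.symm (matUnit R μ ν)) using 1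
  ext g
  have h1 := hφ g _ ((isNormalizer_matUnit hF hF' h).map (symm_mem_diagonal_iff hπ))
  rw [π.apply_symm_apply, ev_matUnit h] at h1
  rw [Set.mem_preimage, Set.mem_ofPred_eq, h1]
  simp

/-- A diagonal-preserving ring `*`-isomorphism of Leavitt path algebras induces an isomorphism
of graph groupoids. -/
theorem nonempty_topologicalGroupoidIso (hE : E.RowFinite) (hE' : E.NoSources)
    (hF : F.RowFinite) (hF' : F.NoSources) (hπ : ∀ a, π a ∈ diagonal R F ↔ a ∈ diagonal R E) :
    Nonempty (TopologicalGroupoidIso E F) := by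
  have hπ' := symm_mem_diagonal_iff hπ
  choose φ hφ using exists_groupoidRel hE hE' hF hF' hπ
  choose ψ hψ using exists_groupoidRel hF hF' hE hE' hπ'
  let Φ : E.GraphGroupoid ≃ₜ F.GraphGroupoid :=
    { toFun := φ
      invFun := ψ
      left_inv := fun g => (hψ (φ g)).eq hF hF' hE hE' hπ' ((hφ g).symm hπ)
      right_inv := fun h => (hφ (ψ h)).eq hE hE' hF hF' hπ ((hψ h).symm hπ')
      continuous_toFun := continuous_of_groupoidRel hF hF' hπ φ hφ
      continuous_invFun := continuous_of_groupoidRel hE hE' hπ' ψ hψ }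
  have hcomp : ∀ g h : E.GraphGroupoid, g.src = h.rng ↔ (φ g).src = (φ h).rng := by
    intro g h
    have h1 := (hφ g).src hE hE' hF hF' hπ
    have h2 := (hφ h).rng hE hE' hF hF' hπ
    constructor
    · intro hc
      exact h1.eq hπ (hc ▸ h2)
    · intro hc
      exact (h1.symm hπ).eq hπ' (hc ▸ h2.symm hπ)
  exact ⟨⟨Φ, hcomp, fun g h hc =>
    (hφ g).comp hE hE' hF hF' hπ (hφ h) hc ((hcomp g h).1 hc) (hφ _)⟩⟩

end Reconstruction

end LeavittPathAlgebra

end DirectedGraph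

theorem theorem5p2 (E : DirectedGraph.{u, v}) (F : DirectedGraph.{u', v'})
    (hE : E.RowFinite) (hE' : E.NoSources) (hF : F.RowFinite) (hF' : F.NoSources)
    (R : Type w) [CommRing R] [IsDomain R] [StarRing R] :
    (∃ π : DirectedGraph.LeavittPathAlgebra R E ≃⋆+* DirectedGraph.LeavittPathAlgebra R F,
      π '' (DirectedGraph.LeavittPathAlgebra.diagonal R E :
          Set (DirectedGraph.LeavittPathAlgebra R E)) =
        (DirectedGraph.LeavittPathAlgebra.diagonal R F :
          Set (DirectedGraph.LeavittPathAlgebra R F))) ↔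
      Nonempty (DirectedGraph.TopologicalGroupoidIso E F) := by
  constructor
  · rintro ⟨π, hπ⟩
    refine DirectedGraph.LeavittPathAlgebra.nonempty_topologicalGroupoidIso (π := π)
      hE hE' hF hF' fun a => ?_
    rw [← SetLike.mem_coe, ← hπ]
    exact π.injective.mem_set_image
  · rintro ⟨Φ⟩
    exact Φ.exists_starRingEquiv hE hE' hF hF'
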